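/- Let $M$ be a closed (compact, without boundary) oriented smooth $n$-manifold and let $\Lambda\in\Gamma(\wedge^nTM)$ be a smooth $n$-vector field which is generic, i.e. its graph is transverse to the zero section of the line bundle $\wedge^nTM$. Let $\mathcal H=\{x\in M:\Lambda_x=0\}$, and let $\Lambda^{-1}$ be the volume form on $M\setminus\mathcal H$ dual to $\Lambda$: if $\Lambda=c\,\partial_{x^1}\wedge\dots\wedge\partial_{x^n}$ in local coordinates, then $\Lambda^{-1}=c^{-1}dx^1\wedge\dots\wedge dx^n$. Say that $h\in C^\infty(M)$ vanishes linearly exactly on $\mathcal H$ if $h^{-1}(0)=\mathcal H$ and $dh_x\neq0$ for every $x\in\mathcal H$ (equivalently, the graph of $h$ is transverse to the zero section and $h$ vanishes exactly at $\mathcal H$). Then functions vanishing linearly exactly on $\mathcal H$ exist; for every such $h$ and every $\varepsilon>0$ the integral (with respect to the given orientation of $M$) $$V_\Lambda^\varepsilon(h)=\int_{\{x\in M:\,|h(x)|\ge\varepsilon\}}\Lambda^{-1}$$ converges absolutely; and the limit $$V_\Lambda=\lim_{\varepsilon\to0^+}V_\Lambda^\varepsilon(h)$$ exists in $\mathbb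 R$ and does not depend on the choice of $h$. That is, there is exactly one real number $V_\Lambda$ such that $V_\Lambda^\varepsilon(h)\to V_\Lambda$ as $\varepsilon\to0^+$ for all functions $h$ vanishing linearly exactly on $\mathcal H$; it is called the regularized Liouville volume of $\Lambda$. -/

import Mathlib

open scoped Manifold ContDiff Topology
open MeasureTheory Filter

noncomputable section

namespace NambuVolume

/-! ### Linear algebra in a tangent space -/

section Linear

variable {n : ℕ} {V : Type*} [AddCommGroup V] [Module ℝ V] [TopologicalSpace V]

/-- `n`-vectors on an `n`-dimensional space `V`, i.e. elements of `⋀ⁿ V`, as alternating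
`n`-linear functions of `n` covectors. -/
abbrev NVector (n : ℕ) (V : Type*) [AddCommGroup V] [Module ℝ V] [TopologicalSpace V] : Type _ :=
  (V →L[ℝ] ℝ) [⋀^Fin n]→ₗ[ℝ] ℝ

/-- `n`-forms on `V`. -/
abbrev NForm (n : ℕ) (V : Type*) [AddCommGroup V] [Module ℝ V] : Type _ :=
  V [⋀^Fin n]→ₗ[ℝ] ℝ

/-- The sign of a frame `v` with respect to an orientation: `1` if `v` is a positively oriented
basis, `-1` if it is a negatively oriented basis, and `0` if it is not a basis. -/
def frameSign (o : Orientation ℝ V (Fin n)) (v : Fin n → V) : ℝ :=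
  (SignType.sign ((Module.Ray.someVector o : NForm n V) v) : ℝ)

end Linear

/-- The model space `ℝⁿ`. -/
abbrev Model (n : ℕ) : Type := EuclideanSpace ℝ (Fin n)

/-- The form dual to an `n`-vector `λ` on `ℝⁿ`: if `λ = c ∂₁ ∧ ⋯ ∧ ∂ₙ` with `c ≠ 0`, it is
`c⁻¹ dx¹ ∧ ⋯ ∧ dxⁿ`; by convention it is `0` if `λ = 0`. -/
def dualForm {n : ℕ} (lam : NVector n (Model n)) : NForm n (Model n) :=
  (lam fun i => EuclideanSpace.proj i)⁻¹ • (EuclideanSpace.basisFun (Fin n) ℝ).toBasis.det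

/-- Coordinate-free description of `dualForm`; it shows that `dualForm` does not depend on the
linear coordinates. -/
theorem dualForm_spec {n : ℕ} (lam : NVector n (Model n)) (hlam : lam ≠ 0)
    (θ : Fin n → (Model n →L[ℝ] ℝ)) (v : Fin n → Model n) :
    lam θ * dualForm lam v = (Matrix.of fun i j => θ i (v j)).det := by
  set b := (EuclideanSpace.basisFun (Fin n) ℝ).toBasis with hb
  let T : Model n →ₗ[ℝ] (Model n →L[ℝ] ℝ) :=
    { toFun := fun x => innerSL ℝ x
      map_add' := fun x y => by ext z; simp
      map_smul' := fun c x => by ext z; simp }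
  have hg := (lam.compLinearMap T).eq_smul_basis_det b
  have hTb : (fun i => T (b i)) = fun i => EuclideanSpace.proj i := by
    funext i
    ext x
    simp [T, hb, innerSL_apply_apply, EuclideanSpace.inner_single_left]
  let w : Fin n → Model n := fun i => (InnerProductSpace.toDual ℝ (Model n)).symm (θ i)
  have hw : ∀ i x, θ i x = inner ℝ (w i) x := fun i x => by
    simp [w, InnerProductSpace.toDual_symm_apply]
  have hT : ∀ w' : Fin n → Model n, lam (fun i => T (w' i)) =
      lam (fun i => EuclideanSpace.proj i) * b.det w' := fun w' => by
    have h1 := congrArg (fun f => f w') hg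
    simp only [AlternatingMap.compLinearMap_apply, AlternatingMap.smul_apply, smul_eq_mul] at h1
    rw [← hTb]
    exact h1
  have hθ : lam θ = lam (fun i => EuclideanSpace.proj i) * b.det w := by
    rw [← hT]
    congr 1
    funext i
    ext x
    simp [T, hw, innerSL_apply_apply]
  have hc : lam (fun i => EuclideanSpace.proj i) ≠ 0 := by
    intro h0
    apply hlam
    ext θ'
    have h2 := hT fun i => (InnerProductSpace.toDual ℝ (Model n)).symm (θ' i)
    rw [h0, zero_mul] at h2
    rw [AlternatingMap.zero_apply, ← h2]
    congr 1
    funext i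
    ext x
    simp [T, innerSL_apply_apply, InnerProductSpace.toDual_symm_apply]
  have hM : (Matrix.of fun i j => θ i (v j)) = (b.toMatrix w).transpose * b.toMatrix v := by
    ext i j
    simp [Matrix.mul_apply, hw, hb, Module.Basis.toMatrix_apply, PiLp.inner_apply, mul_comm]
  rw [hM, Matrix.det_mul, Matrix.det_transpose, hθ, dualForm, AlternatingMap.smul_apply, smul_eq_mul,
    Module.Basis.det_apply, Module.Basis.det_apply, ← hb]
  field_simp

/-! ### Fields on a manifold -/

section Manifold

variable {n : ℕ} {M : Type*} [TopologicalSpace M] [ChartedSpace (Model n) M]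

/-- The coordinate frame `∂/∂x¹, …, ∂/∂xⁿ` at `x` of a chart `e`. -/
def chartFrame (e : OpenPartialHomeomorph M (Model n)) (x : M) :
    Fin n → TangentSpace (𝓡 n) x :=
  fun i => mfderiv (𝓡 n) (𝓡 n) e.symm (e x) (EuclideanSpace.single i (1 : ℝ))

/-- The coordinate coframe `dx¹, …, dxⁿ` at `x` of a chart `e`. -/
def chartCoframe (e : OpenPartialHomeomorph M (Model n)) (x : M) :
    Fin n → (TangentSpace (𝓡 n) x →L[ℝ] ℝ) :=
  fun i => mfderiv (𝓡 n) 𝓘(ℝ, ℝ) (fun y : M => e y i) x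

variable (n M) in
/-- (Not necessarily continuous) fields of `n`-vectors on `M`, i.e. sections of `⋀ⁿ TM`. -/
abbrev NVectorField : Type _ := ∀ x : M, NVector n (TangentSpace (𝓡 n) x)

variable (n M) in
/-- (Not necessarily continuous) fields of `n`-forms on `M`, i.e. sections of `⋀ⁿ T*M`. -/
abbrev NFormField : Type _ := ∀ x : M, NForm n (TangentSpace (𝓡 n) x)

variable (n M) in
/-- An orientation of the manifold `M`: an orientation of each tangent space such that, near each
point, the coordinate frame of the chart at that point does not change sign. -/
structure ManifoldOrientation where
  /-- the orientation of the tangent space at `x` -/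
  orient : ∀ x : M, Orientation ℝ (TangentSpace (𝓡 n) x) (Fin n)
  continuous_orient : ∀ p : M, ∀ᶠ x in 𝓝 p,
    frameSign (orient x) (chartFrame (chartAt (Model n) p) x) =
      frameSign (orient p) (chartFrame (chartAt (Model n) p) p)

/-- The coefficient `c` of `Λ = c ∂/∂x¹ ∧ ⋯ ∧ ∂/∂xⁿ` in a chart `e`, that is, the bracket
`{x¹, …, xⁿ}` of the coordinate functions. -/
def coeff (Λ : NVectorField n M) (e : OpenPartialHomeomorph M (Model n)) (x : M) : ℝ :=
  Λ x (chartCoframe e x)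

/-- Smooth `n`-vector fields. -/
def IsSmooth (Λ : NVectorField n M) : Prop :=
  ∀ p : M, ContMDiffOn (𝓡 n) 𝓘(ℝ, ℝ) ∞ (coeff Λ (chartAt (Model n) p)) (chartAt (Model n) p).source

/-- A generic Nambu structure of top degree: a smooth `n`-vector field whose graph is transverse to
the zero section of `⋀ⁿ TM`. As `⋀ⁿ TM` is a line bundle, transversality at a zero `x` means that
the differential at `x` of the coefficient of `Λ` in a chart around `x` is nonzero. -/
structure IsGeneric (Λ : NVectorField n M) : Prop where
  smooth : IsSmooth Λ
  transverse : ∀ x : M, Λ x = 0 →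
    mfderiv (𝓡 n) 𝓘(ℝ, ℝ) (coeff Λ (chartAt (Model n) x)) x ≠ 0

/-- The zero locus of `Λ`. -/
def zeroLocus (Λ : NVectorField n M) : Set M := {x | Λ x = 0}

variable (n) in
/-- `h` is a smooth function that vanishes exactly on `Z`, and vanishes linearly there: its graph is
transverse to the zero section, i.e. `dh` is nonzero at every zero of `h`. -/
structure VanishesLinearlyExactlyOn (h : M → ℝ) (Z : Set M) : Prop where
  smooth : ContMDiff (𝓡 n) 𝓘(ℝ, ℝ) ∞ h
  zero_iff : ∀ x : M, h x = 0 ↔ x ∈ Z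
  transverse : ∀ x : M, h x = 0 → mfderiv (𝓡 n) 𝓘(ℝ, ℝ) h x ≠ 0

/-- The form `Λ⁻¹` dual to `Λ`, a volume form off the zero locus of `Λ`. -/
def inverseForm (Λ : NVectorField n M) : NFormField n M :=
  fun x => dualForm (Λ x)

/-- The set `{|h| ≥ ε}`. -/
def outside (h : M → ℝ) (ε : ℝ) : Set M := {x | ε ≤ |h x|}

/-! ### Integration of `n`-forms over an oriented closed manifold -/

/-- The density in a chart `e`, as a function of the coordinates `y`, of the `n`-form `η` on the
oriented manifold `M`: it is `f` where `η = f dx¹ ∧ ⋯ ∧ dxⁿ` if the chart is positively oriented at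
the point, and `-f` otherwise. -/
def chartDensity (o : ManifoldOrientation n M) (η : NFormField n M)
    (e : OpenPartialHomeomorph M (Model n)) (y : Model n) : ℝ :=
  frameSign (o.orient (e.symm y)) (chartFrame e (e.symm y)) *
    η (e.symm y) (chartFrame e (e.symm y))

variable [T2Space M] [CompactSpace M] [IsManifold (𝓡 n) ∞ M]

variable (n M) in
theorem exists_partition : ∃ ρ : SmoothPartitionOfUnity M (𝓡 n) M Set.univ,
    ρ.IsSubordinate fun p => (chartAt (Model n) p).source :=
  SmoothPartitionOfUnity.exists_isSubordinate (𝓡 n) isClosed_univ _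
    (fun p => (chartAt (Model n) p).open_source)
    (fun x _ => Set.mem_iUnion.2 ⟨x, mem_chart_source (Model n) x⟩)

variable (n M) in
/-- A smooth partition of unity subordinate to the chart domains. As `M` is compact, only finitely
many of its functions are nonzero. -/
def partition : SmoothPartitionOfUnity M (𝓡 n) M Set.univ := (exists_partition n M).choose

/-- The expression in the chart at `p` of `ρ_p 1_A η`, where `ρ` is the partition of unity. -/
def localIntegrand (o : ManifoldOrientation n M) (η : NFormField n M) (A : Set M) (p : M)
    (y : Model n) : ℝ :=
  partition n M p ((chartAt (Model n) p).symm y) *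
    A.indicator 1 ((chartAt (Model n) p).symm y) *
    chartDensity o η (chartAt (Model n) p) y

/-- The `n`-form `η` is absolutely integrable over `A ⊆ M`. -/
def FormIntegrableOn (o : ManifoldOrientation n M) (η : NFormField n M) (A : Set M) : Prop :=
  ∀ p : M, IntegrableOn (localIntegrand o η A p) (chartAt (Model n) p).target volume

/-- The integral of the `n`-form `η` over the subset `A` of the oriented closed manifold `M`,
computed as usual in charts with a partition of unity. -/
def formIntegral (o : ManifoldOrientation n M) (η : NFormField n M) (A : Set M) : ℝ :=
  ∑ᶠ p : M, ∫ y in (chartAt (Model n) p).target, localIntegrand o η A p y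

/-- `V_Λ^ε(h)`, the integral of `Λ⁻¹` over `{|h| ≥ ε}`. -/
def truncatedVolume (o : ManifoldOrientation n M) (Λ : NVectorField n M) (h : M → ℝ) (ε : ℝ) : ℝ :=
  formIntegral o (inverseForm Λ) (outside h ε)

end Manifold

end NambuVolume

end

/-! In a chart $\Lambda^{-1}=c^{-1}dx$, where $c$ is the coefficient of $\Lambda$. With a partition
of unity and the locally constant orientation signs, the problem becomes the limit of
$\int_{\{|h|\ge\varepsilon\}} f/c$ for $f$ smooth with compact support.

Since $c$ vanishes linearly, $1=\sum_i a_i\,\partial_{v_i}c+a_0c$ with smooth coefficients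
(`exists_fderiv_combination`), so $f/c=\sum_i fa_i\,\partial_{v_i}c/c+fa_0$. The last term is
harmless. The others contain logarithmic derivatives, treated in
`tendsto_integral_indicator_fderiv_div`. Write $h=uc$ with $u$ nowhere zero and locally Lipschitz,
and put $F_\varepsilon=\log\max(|h|,\varepsilon)-\log|u|$. This function is locally Lipschitz,
equals $\log|c|$ where $|h|\ge\varepsilon$, and has the derivative of $-\log|u|$ where
$|h|<\varepsilon$. Integration by parts turns the truncated integral of $g\,\partial_vc/c$ into
$-\int F_\varepsilon\,\partial_vg$ plus an integral over $\{|h|<\varepsilon\}$ that tends to $0$.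
The limit $-\int\log|c|\,\partial_vg$ no longer involves $h$.

Two facts support this. Hadamard's lemma (`exists_locallyLipschitzOn_quotient`) supplies $u$; the
Lipschitz property is all that the integration by parts needs. By
`measure_zero_and_integrableOn_log`, the zero set is null and $\log|c|$ is locally integrable; this
follows from a regularized integration by parts and Fatou's lemma, without straightening the
hypersurface. Throughout, `Real.log` stands for $\log|\cdot|$.

A function $h$ exists because the coefficients of $\Lambda$, corrected by the orientation signs,
agree in sign on overlaps: their sum over the partition of unity has no cancellation. -/

noncomputable section

namespace NambuVolume

/-! ### Division of one linearly vanishing function by another -/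

section Hadamard

variable {E F : Type*} [NormedAddCommGroup E] [NormedSpace ℝ E] [CompleteSpace E]
  [NormedAddCommGroup F] [NormedSpace ℝ F]

/-- The distance to the zero set of a submersion is controlled by its value. -/
theorem exists_zero_dist_le {c : E → ℝ} {c' : E →L[ℝ] ℝ} {z : E}
    (hc : HasStrictFDerivAt c c' z) (hz : c z = 0) (hc' : c' ≠ 0) :
    ∃ C : ℝ, 0 < C ∧ ∀ N ∈ 𝓝 z, ∀ᶠ x in 𝓝 z, ∃ y ∈ N, c y = 0 ∧ dist x y ≤ C * |c x| := by
  have hsurj : c'.range = ⊤ := by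
    rw [LinearMap.range_eq_top]
    exact LinearMap.surjective (f := (c' : E →ₗ[ℝ] ℝ)) (by
      intro h; apply hc'; ext x; exact congrArg (fun f => f x) h)
  set R := c'.nonlinearRightInverseOfSurjective hsurj
  have hR : 0 < R.nnnorm := c'.nonlinearRightInverseOfSurjective_nnnorm_pos hsurj
  -- With this error, the image of a ball of radius $r$ about $x$ covers the ball of radius
  -- $r/(2\|R\|)$ about $c(x)$. Radius $2\|R\||c(x)|$ therefore suffices to reach the value $0$.
  obtain ⟨s, hs, happ⟩ := hc.approximates_deriv_on_nhds (c := R.nnnorm⁻¹ / 2)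
    (Or.inr (by positivity))
  have hR' : (0 : ℝ) < R.nnnorm := hR
  refine ⟨2 * R.nnnorm, by positivity, fun N hN => ?_⟩
  obtain ⟨r, hr, hrs⟩ := Metric.mem_nhds_iff.1 (inter_mem hs hN)
  have hcont : ContinuousAt c z := hc.hasFDerivAt.continuousAt
  have h1 : ∀ᶠ x in 𝓝 z, 2 * R.nnnorm * |c x| < r / 2 := by
    have : Tendsto (fun x => 2 * (R.nnnorm : ℝ) * |c x|) (𝓝 z) (𝓝 (2 * R.nnnorm * |c z|)) :=
      (hcont.abs.const_mul _)
    rw [hz, abs_zero, mul_zero] at this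
    exact this.eventually (gt_mem_nhds (by positivity))
  filter_upwards [h1, Metric.ball_mem_nhds z (half_pos hr)] with x hx hxz
  have hball : Metric.closedBall x (2 * R.nnnorm * |c x|) ⊆ s ∩ N := by
    intro y hy
    apply hrs
    rw [Metric.mem_ball] at hxz ⊢
    rw [Metric.mem_closedBall] at hy
    linarith [dist_triangle y x z]
  have hsurjOn := happ.surjOn_closedBall_of_nonlinearRightInverse R
    (ε := 2 * R.nnnorm * |c x|) (b := x) (by positivity) (hball.trans Set.inter_subset_left)
  obtain ⟨y, hy, hy0⟩ := hsurjOn (a := 0) (by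
    rw [Metric.mem_closedBall, Real.dist_eq, zero_sub, abs_neg]
    apply le_of_eq
    push_cast
    field_simp
    norm_num)
  exact ⟨y, (hball hy).2, hy0, by rw [dist_comm]; exact hy⟩

/-- A map which vanishes to second order on the zero set of a submersion `c` is `O(c²)`. -/
theorem norm_le_sq_of_vanish {c : E → ℝ} {c' : E →L[ℝ] ℝ} {z : E}
    (hc : HasStrictFDerivAt c c' z) (hz : c z = 0) (hc' : c' ≠ 0) {k : E → F}
    (hk : ContDiffAt ℝ 2 k z) (h0 : ∀ᶠ y in 𝓝 z, c y = 0 → k y = 0 ∧ fderiv ℝ k y = 0) :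
    ∃ C : ℝ, ∀ᶠ x in 𝓝 z, ‖k x‖ ≤ C * c x ^ 2 := by
  obtain ⟨C, hC, hproj⟩ := exists_zero_dist_le hc hz hc'
  have hk' : ContDiffAt ℝ 1 (fderiv ℝ k) z := hk.fderiv_right (by norm_num)
  obtain ⟨L, t, ht, hL⟩ := hk'.exists_lipschitzOnWith
  have hd : ∀ᶠ y in 𝓝 z, DifferentiableAt ℝ k y :=
    ((hk.of_le (by norm_num : (1 : WithTop ℕ∞) ≤ 2)).eventually (by simp)).mono
      fun y hy => hy.differentiableAt (by norm_num)
  obtain ⟨r, hr, hball⟩ := Metric.mem_nhds_iff.1 (inter_mem ht (inter_mem hd h0))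
  refine ⟨L * C ^ 2, ?_⟩
  filter_upwards [hproj _ (Metric.ball_mem_nhds z hr), Metric.ball_mem_nhds z hr]
    with x ⟨y, hy, hy0, hxy⟩ hx
  obtain ⟨hky, hky'⟩ := (hball hy).2.2 hy0
  have hseg : segment ℝ y x ⊆ Metric.ball z r := (convex_ball z r).segment_subset hy hx
  -- The derivative of $k$ is $L$-Lipschitz and vanishes at the nearby zero $y$, so it is at most
  -- $L|x-y|$ on the segment; the mean value inequality supplies the second factor $|x-y|$.
  have := (convex_segment (𝕜 := ℝ) y x).norm_image_sub_le_of_norm_fderiv_le (f := k)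
    (C := L * dist x y) (𝕜 := ℝ)
    (fun w hw => (hball (hseg hw)).2.1) (fun w hw => by
      have h1 := hL.dist_le_mul w (hball (hseg hw)).1 y (hball hy).1
      rw [hky', dist_zero_right] at h1
      refine h1.trans ?_
      gcongr
      have := segment_subset_closedBall_left y x hw
      simpa [dist_comm, dist_eq_norm] using this)
    (left_mem_segment ℝ y x) (right_mem_segment ℝ y x)
  rw [hky, sub_zero, ← dist_eq_norm] at this
  refine this.trans ?_
  calc L * dist x y * dist x y = L * dist x y ^ 2 := by ring
    _ ≤ L * (C * |c x|) ^ 2 := by gcongr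
    _ = L * C ^ 2 * c x ^ 2 := by rw [mul_pow, sq_abs]; ring

/-- At a common zero, the differential of a function that vanishes on the zero set of `c` is a
multiple of the differential of `c`. -/
theorem exists_fderiv_eq_smul {c h : E → ℝ} {c' h' : E →L[ℝ] ℝ} {z : E}
    (hc : HasStrictFDerivAt c c' z) (hh : HasStrictFDerivAt h h' z) (hz : c z = 0) (hc' : c' ≠ 0)
    (h0 : ∀ᶠ y in 𝓝 z, c y = 0 → h y = 0) : ∃ a : ℝ, h' = a • c' := by
  -- As $h$ is zero on the level set of $c$ near $z$, the point is a degenerate constrained extremum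
  -- and Lagrange multipliers apply.
  have hext : IsLocalExtrOn h {x | c x = c z} z := by
    left
    have hhz := h0.self_of_nhds hz
    refine Filter.eventually_of_mem (inter_mem_nhdsWithin _ h0) ?_
    rintro x ⟨hx, hx'⟩
    rw [hhz, hx' (hx.trans hz)]
  obtain ⟨a, b, hab, hsum⟩ := hext.exists_multipliers_of_hasStrictFDerivAt_1d hc hh
  have hb : b ≠ 0 := by
    rintro rfl
    rw [zero_smul, add_zero] at hsum
    rcases smul_eq_zero.1 hsum with rfl | h
    · exact hab rfl
    · exact hc' h
  refine ⟨-(b⁻¹ * a), ?_⟩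
  ext x
  have h2 : a * c' x + b * h' x = 0 := by simpa using congrArg (fun f => f x) hsum
  simp only [smul_apply, smul_eq_mul]
  field_simp
  linarith

/-- The quotient of two functions with the same zero set, `c` being a submersion there, is
Lipschitz near each zero. -/
theorem exists_lipschitzOnWith_quotient {c h u : E → ℝ} {z : E} (hc : ContDiffAt ℝ 3 c z)
    (hh : ContDiffAt ℝ 3 h z) (hz : c z = 0) (hc' : fderiv ℝ c z ≠ 0)
    (h0 : ∀ᶠ y in 𝓝 z, c y = 0 → h y = 0)
    (hu : ∀ᶠ y in 𝓝 z, c y ≠ 0 → u y = h y / c y)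
    (hu0 : ∀ᶠ y in 𝓝 z, c y = 0 → fderiv ℝ h y = u y • fderiv ℝ c y) :
    ∃ C, ∃ t ∈ 𝓝 z, LipschitzOnWith C u t := by
  obtain ⟨v, hv⟩ : ∃ v, fderiv ℝ c z v ≠ 0 := by
    by_contra! H
    exact hc' (by ext v; exact H v)
  have hcd : ContDiffAt ℝ 2 (fderiv ℝ c) z := hc.fderiv_right (by norm_num)
  have hhd : ContDiffAt ℝ 2 (fderiv ℝ h) z := hh.fderiv_right (by norm_num)
  have hc2 : ContDiffAt ℝ 2 c z := hc.of_le (by norm_num)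
  have hh2 : ContDiffAt ℝ 2 h z := hh.of_le (by norm_num)
  have hcs : HasStrictFDerivAt c (fderiv ℝ c z) z := hc.hasStrictFDerivAt (by norm_num)
  have hdiff : ∀ f : E → ℝ, ContDiffAt ℝ 3 f z → ∀ᶠ y in 𝓝 z,
      DifferentiableAt ℝ f y ∧ DifferentiableAt ℝ (fderiv ℝ f) y := fun f hf => by
    have h1 := hf.eventually (by simp)
    filter_upwards [h1] with y hy
    exact ⟨hy.differentiableAt (by norm_num),
      (hy.fderiv_right (m := 2) (by norm_num)).differentiableAt (by norm_num)⟩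
  -- Off the zeros, $du=-c^{-2}(h\,dc-c\,dh)$. The bracket vanishes to second order on $\{c=0\}$:
  -- its derivative there is the antisymmetrization of $dh\otimes dc$, and $dh=u\,dc$. Hence $du$ is
  -- bounded.
  obtain ⟨C, hC⟩ := norm_le_sq_of_vanish hcs hz hc'
    (k := fun x => h x • fderiv ℝ c x - c x • fderiv ℝ h x)
    ((hh2.smul hcd).sub (hc2.smul hhd)) (by
      filter_upwards [hdiff c hc, hdiff h hh, h0, hu0] with y hcy hhy hy0 hyu hy
      refine ⟨by simp [hy, hy0 hy], ?_⟩
      have := ((hhy.1.hasFDerivAt.smul hcy.2.hasFDerivAt).sub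
        (hcy.1.hasFDerivAt.smul hhy.2.hasFDerivAt)).fderiv
      refine Eq.trans this ?_
      rw [hy, hy0 hy, hyu hy]
      ext a b
      simp
      ring)
  -- A $C^1$ comparison function: it equals $u$ on the zero set, and
  -- $u-w=(h\,dc-c\,dh)(v)/(c\,\partial_vc)=O(c)$ elsewhere.
  set w : E → ℝ := fun x => fderiv ℝ h x v / fderiv ℝ c x v with hw
  have hwd : ContDiffAt ℝ 1 w z :=
    ((hhd.of_le (by norm_num)).clm_apply contDiffAt_const).div
      ((hcd.of_le (by norm_num)).clm_apply contDiffAt_const) hv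
  obtain ⟨W, tw, htw, hW⟩ := hwd.exists_lipschitzOnWith
  obtain ⟨L, tc, htc, hL⟩ := (hc.of_le (by norm_num) : ContDiffAt ℝ 1 c z).exists_lipschitzOnWith
  set m := |fderiv ℝ c z v| / 2 with hm
  have hmpos : 0 < m := by positivity
  have hcv : ∀ᶠ x in 𝓝 z, m < |fderiv ℝ c x v| := by
    have : ContinuousAt (fun x => |fderiv ℝ c x v|) z :=
      (hcd.continuousAt.clm_apply continuousAt_const).abs
    exact this.eventually (lt_mem_nhds (by rw [hm]; linarith [abs_pos.2 hv]))
  have hall := hC.and <| hcv.and <| (hdiff c hc).and <| (hdiff h hh).and <| h0.and <| hu.and hu0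
  obtain ⟨r, hr, hball⟩ := Metric.mem_nhds_iff.1 (inter_mem htw (inter_mem htc hall))
  set B := Metric.ball z r
  have hdist : ∀ x ∈ B, |u x - w x| ≤ |C| * ‖v‖ / m * |c x| := by
    intro x hx
    obtain ⟨hKx, hcvx, -, -, hx0, hux, hux0⟩ := (hball hx).2.2
    have hcvx0 : fderiv ℝ c x v ≠ 0 := fun h => by rw [h, abs_zero] at hcvx; linarith
    by_cases hcx : c x = 0
    · have : u x = w x := by rw [hw]; simp only [hux0 hcx]; simp [hcvx0]
      rw [this, sub_self, abs_zero]; positivity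
    · have h1 : u x - w x =
          (h x • fderiv ℝ c x - c x • fderiv ℝ h x) v / (c x * fderiv ℝ c x v) := by
        rw [hux hcx, hw]
        simp
        field_simp
      rw [h1, abs_div, abs_mul, div_le_iff₀ (by positivity)]
      calc |(h x • fderiv ℝ c x - c x • fderiv ℝ h x) v|
          ≤ ‖h x • fderiv ℝ c x - c x • fderiv ℝ h x‖ * ‖v‖ :=
            (h x • fderiv ℝ c x - c x • fderiv ℝ h x).le_opNorm v
        _ ≤ |C| * |c x| ^ 2 * ‖v‖ := by
            gcongr
            refine hKx.trans ?_
            rw [sq_abs]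
            gcongr
            exact le_abs_self C
        _ = |C| * ‖v‖ / m * |c x| * (|c x| * m) := by field_simp
        _ ≤ _ := by gcongr
  have hder : ∀ x ∈ B, c x ≠ 0 → DifferentiableAt ℝ u x ∧ ‖fderiv ℝ u x‖ ≤ |C| := by
    intro x hx hcx
    obtain ⟨hKx, -, hcd, hhd, -, -, -⟩ := (hball hx).2.2
    have hev : u =ᶠ[𝓝 x] fun y => h y / c y := by
      filter_upwards [Metric.isOpen_ball.mem_nhds hx, hcd.1.continuousAt.eventually_ne hcx]
        with y hy hcy
      exact (hball hy).2.2.2.2.2.2.2.1 hcy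
    have hd := hhd.1.hasFDerivAt.mul ((hasDerivAt_inv hcx).comp_hasFDerivAt x hcd.1.hasFDerivAt)
    have hd' : HasFDerivAt u
        (-((c x ^ 2)⁻¹ • (h x • fderiv ℝ c x - c x • fderiv ℝ h x))) x := by
      have e : -((c x ^ 2)⁻¹ • (h x • fderiv ℝ c x - c x • fderiv ℝ h x)) =
          h x • -(c x ^ 2)⁻¹ • fderiv ℝ c x + (c x)⁻¹ • fderiv ℝ h x := by
        ext a
        simp
        field_simp
        ring
      rw [e]
      exact HasFDerivAt.congr_of_eventuallyEq hd (hev.trans (by simp [div_eq_mul_inv]; rfl))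
    refine ⟨hd'.differentiableAt, ?_⟩
    rw [hd'.fderiv, norm_neg, norm_smul, norm_inv, norm_pow,
      Real.norm_eq_abs, sq_abs, inv_mul_le_iff₀ (by positivity), mul_comm]
    refine hKx.trans ?_
    gcongr
    exact le_abs_self C
  set A : ℝ := |C| * ‖v‖ / m with hA
  have hA0 : 0 ≤ A := by positivity
  refine ⟨Real.toNNReal (|C| + A * L + W + A * (2 * L)), B, Metric.ball_mem_nhds z hr,
    LipschitzOnWith.of_dist_le_mul fun x hx y hy => ?_⟩
  rw [Real.coe_toNNReal _ (by positivity)]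
  have hcxy := hL.dist_le_mul x (hball hx).2.1 y (hball hy).2.1
  rw [Real.dist_eq] at hcxy
  have hxy0 : 0 ≤ dist x y := dist_nonneg
  have hL0 : (0 : ℝ) ≤ L := L.2
  have hW0 : (0 : ℝ) ≤ W := W.2
  -- Either the segment from $x$ to $y$ misses the zero set and the bound on $du$ applies along it,
  -- or $|c|$ is $O(|x-y|)$ at both ends and $u$ may be replaced by $w$.
  rcases lt_or_ge (L * dist x y) |c x| with hlt | hge
  · have hseg : segment ℝ x y ⊆ B := (convex_ball z r).segment_subset hx hy
    have hne : ∀ p ∈ segment ℝ x y, c p ≠ 0 := by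
      intro p hp hcp
      have h1 := hL.dist_le_mul x (hball hx).2.1 p (hball (hseg hp)).2.1
      rw [Real.dist_eq, hcp, sub_zero] at h1
      have h2 : dist x p ≤ dist x y := by
        have := segment_subset_closedBall_left x y hp
        simpa [dist_comm] using this
      have h3 : (L : ℝ) * dist x p ≤ L * dist x y := by gcongr
      linarith
    have := (convex_segment (𝕜 := ℝ) x y).norm_image_sub_le_of_norm_fderiv_le (f := u)
      (C := |C|) (𝕜 := ℝ) (fun p hp => (hder p (hseg hp) (hne p hp)).1)
      (fun p hp => (hder p (hseg hp) (hne p hp)).2)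
      (right_mem_segment ℝ x y) (left_mem_segment ℝ x y)
    rw [← dist_eq_norm, ← dist_eq_norm] at this
    refine this.trans ?_
    gcongr
    have : 0 ≤ A * L + W + A * (2 * L) := by positivity
    linarith
  · have h1 := hdist x hx
    have h2 := hdist y hy
    have h3 := hW.dist_le_mul x (hball hx).1 y (hball hy).1
    rw [Real.dist_eq] at h3 ⊢
    have h4 : |c y| ≤ 2 * L * dist x y := by
      have : |c y| ≤ |c x| + |c x - c y| := by
        have := abs_sub_abs_le_abs_sub (c y) (c x)
        rw [abs_sub_comm] at this
        linarith
      linarith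
    have h5 : |u x - u y| ≤ |u x - w x| + |w x - w y| + |u y - w y| := by
      have e : u x - u y = (u x - w x) + (w x - w y) - (u y - w y) := by ring
      rw [e]
      exact (abs_sub _ _).trans (add_le_add_left (abs_add_le _ _) _)
    have h6 : A * |c x| ≤ A * (L * dist x y) := by gcongr
    have h7 : A * |c y| ≤ A * (2 * L * dist x y) := by gcongr
    have h8 : 0 ≤ |C| * dist x y := by positivity
    nlinarith

/-- Hadamard's lemma: if `c` and `h` have the same zeros in `U` and vanish linearly there, then
`h = u c` with a nowhere vanishing locally Lipschitz function `u`. -/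
theorem exists_locallyLipschitzOn_quotient {U : Set E} (hU : IsOpen U) {c h : E → ℝ}
    (hc : ContDiffOn ℝ ∞ c U) (hh : ContDiffOn ℝ ∞ h U) (h0 : ∀ x ∈ U, h x = 0 ↔ c x = 0)
    (hc' : ∀ x ∈ U, c x = 0 → fderiv ℝ c x ≠ 0) (hh' : ∀ x ∈ U, h x = 0 → fderiv ℝ h x ≠ 0) :
    ∃ u : E → ℝ, LocallyLipschitzOn U u ∧ ∀ x ∈ U, u x ≠ 0 ∧ h x = u x * c x := by
  have hcA : ∀ x ∈ U, ContDiffAt ℝ 3 c x := fun x hx =>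
    (hc.contDiffAt (hU.mem_nhds hx)).of_le (by norm_cast)
  have hhA : ∀ x ∈ U, ContDiffAt ℝ 3 h x := fun x hx =>
    (hh.contDiffAt (hU.mem_nhds hx)).of_le (by norm_cast)
  have key : ∀ x : E, ∃ a : ℝ, (c x ≠ 0 → a = h x / c x) ∧
      (x ∈ U → c x = 0 → fderiv ℝ h x = a • fderiv ℝ c x) := by
    intro x
    by_cases hx : x ∈ U ∧ c x = 0
    · obtain ⟨a, ha⟩ := exists_fderiv_eq_smul ((hcA x hx.1).hasStrictFDerivAt (by norm_num))
        ((hhA x hx.1).hasStrictFDerivAt (by norm_num)) hx.2 (hc' x hx.1 hx.2)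
        (Filter.eventually_of_mem (hU.mem_nhds hx.1) fun y hy => (h0 y hy).2)
      exact ⟨a, fun h => absurd hx.2 h, fun _ _ => ha⟩
    · exact ⟨h x / c x, fun _ => rfl, fun h1 h2 => absurd ⟨h1, h2⟩ hx⟩
  choose u hu hu0 using key
  refine ⟨u, fun z hz => ?_, fun x hx => ?_⟩
  · rw [hU.nhdsWithin_eq hz]
    by_cases hcz : c z = 0
    · exact exists_lipschitzOnWith_quotient (hcA z hz) (hhA z hz) hcz (hc' z hz hcz)
        (Filter.eventually_of_mem (hU.mem_nhds hz) fun y hy => (h0 y hy).2)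
        (Eventually.of_forall hu)
        (Filter.eventually_of_mem (hU.mem_nhds hz) fun y hy => hu0 y hy)
    · have h1 : ContDiffAt ℝ 1 (fun y => h y / c y) z :=
        ((hhA z hz).div (hcA z hz) hcz).of_le (by norm_num)
      refine (h1.congr_of_eventuallyEq ?_).exists_lipschitzOnWith
      filter_upwards [(hcA z hz).continuousAt.eventually_ne hcz] with y hy using hu y hy
  · by_cases hcx : c x = 0
    · have hhx := (h0 x hx).2 hcx
      refine ⟨fun h => hh' x hx hhx ?_, by rw [hcx, hhx, mul_zero]⟩
      rw [hu0 x hx hcx, h, zero_smul]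
    · rw [hu x hcx]
      exact ⟨div_ne_zero (fun h => hcx ((h0 x hx).1 h)) hcx, by field_simp⟩

end Hadamard

/-! ### Products with cutoffs, and locally Lipschitz compositions -/

section Cutoff

variable {E : Type*} [NormedAddCommGroup E]

theorem continuous_mul_of_tsupport_subset {U : Set E} (hU : IsOpen U) {g k : E → ℝ}
    (hg : Continuous g) (hgU : tsupport g ⊆ U) (hk : ContinuousOn k U) :
    Continuous fun x => g x * k x := by
  rw [continuous_iff_continuousAt]
  intro x
  by_cases hx : x ∈ tsupport g
  · exact hg.continuousAt.mul (hk.continuousAt (hU.mem_nhds (hgU hx)))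
  · refine (continuousAt_const (y := (0 : ℝ))).congr ?_
    filter_upwards [(isClosed_tsupport g).isOpen_compl.mem_nhds hx] with y hy
    rw [image_eq_zero_of_notMem_tsupport hy, zero_mul]

theorem tsupport_mul_subset {g k : E → ℝ} : (tsupport fun x => g x * k x) ⊆ tsupport g :=
  closure_mono fun _ hx => left_ne_zero_of_mul hx

theorem locallyLipschitzOn_comp {U : Set E} (hU : IsOpen U) {f : E → ℝ} {φ : ℝ → ℝ}
    (hf : LocallyLipschitzOn U f)
    (hφ : ∀ x ∈ U, ∃ K, ∃ t ∈ 𝓝 (f x), LipschitzOnWith K φ t) :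
    LocallyLipschitzOn U fun x => φ (f x) := by
  intro x hx
  obtain ⟨K, s, hs, hKs⟩ := hf hx
  obtain ⟨L, t, ht, hLt⟩ := hφ x hx
  have hcont := (hf.continuousOn.continuousAt (hU.mem_nhds hx))
  refine ⟨L * K, s ∩ f ⁻¹' t, inter_mem hs (mem_nhdsWithin_of_mem_nhds (hcont ht)), ?_⟩
  exact hLt.comp (hKs.mono Set.inter_subset_left) fun y hy => hy.2

theorem locallyLipschitzOn_log {U : Set E} (hU : IsOpen U) {f : E → ℝ}
    (hf : LocallyLipschitzOn U f) (h0 : ∀ x ∈ U, f x ≠ 0) :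
    LocallyLipschitzOn U fun x => Real.log (f x) :=
  locallyLipschitzOn_comp hU hf fun x hx =>
    ((Real.contDiffAt_log.2 (h0 x hx)).of_le le_top :
      ContDiffAt ℝ 1 Real.log (f x)).exists_lipschitzOnWith

variable [NormedSpace ℝ E]

theorem contDiff_mul_of_tsupport_subset {U : Set E} (hU : IsOpen U) {g k : E → ℝ}
    (hg : ContDiff ℝ ∞ g) (hgU : tsupport g ⊆ U) (hk : ContDiffOn ℝ ∞ k U) :
    ContDiff ℝ ∞ fun x => g x * k x := by
  rw [contDiff_iff_contDiffAt]
  intro x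
  by_cases hx : x ∈ tsupport g
  · exact hg.contDiffAt.mul (hk.contDiffAt (hU.mem_nhds (hgU hx)))
  · refine (contDiffAt_const (c := (0 : ℝ))).congr_of_eventuallyEq ?_
    filter_upwards [(isClosed_tsupport g).isOpen_compl.mem_nhds hx] with y hy
    rw [image_eq_zero_of_notMem_tsupport hy, zero_mul]

theorem locallyLipschitzOn_of_contDiffOn {U : Set E} (hU : IsOpen U) {f : E → ℝ}
    (hf : ContDiffOn ℝ 1 f U) : LocallyLipschitzOn U f := by
  intro x hx
  rw [hU.nhdsWithin_eq hx]
  exact (hf.contDiffAt (hU.mem_nhds hx)).exists_lipschitzOnWith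

end Cutoff

/-! ### Integration by parts and local integrability of the logarithm -/

section Integration

theorem integrable_mul_of_tsupport_subset {E : Type*} [NormedAddCommGroup E]
    [MeasurableSpace E] [BorelSpace E] (μ : Measure E) [IsFiniteMeasureOnCompacts μ] {U : Set E}
    (hU : IsOpen U) {g k : E → ℝ}
    (hg : Continuous g) (hgc : HasCompactSupport g) (hgU : tsupport g ⊆ U)
    (hk : ContinuousOn k U) : Integrable (fun x => g x * k x) μ :=
  (continuous_mul_of_tsupport_subset hU hg hgU hk).integrable_of_hasCompactSupport
    (hgc.mul_right (f' := k))

variable {E : Type*} [NormedAddCommGroup E] [NormedSpace ℝ E] [FiniteDimensional ℝ E]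
  [MeasurableSpace E] [BorelSpace E] (μ : Measure E) [μ.IsAddHaarMeasure]

/-- Integration by parts for a function that is locally Lipschitz near the support of a compactly
supported `C¹` function. -/
theorem integral_lineDeriv_mul_eq_neg {U : Set E} (hU : IsOpen U) {f g : E → ℝ}
    (hf : LocallyLipschitzOn U f) (hg : ContDiff ℝ 1 g) (hgc : HasCompactSupport g)
    (hgU : tsupport g ⊆ U) (v : E) :
    Integrable (fun x => lineDeriv ℝ f x v * g x) μ ∧
      ∫ x, lineDeriv ℝ f x v * g x ∂μ = -∫ x, f x * fderiv ℝ g x v ∂μ := by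
  -- Only values of $f$ near the support of $g$ matter, so $f$ is replaced by a global Lipschitz
  -- extension $F$ of its restriction to a compact neighbourhood of that support.
  obtain ⟨K, hK, hgK, hKU⟩ := exists_compact_between hgc hU hgU
  obtain ⟨C, hC⟩ := LocallyLipschitzOn.exists_lipschitzOnWith_of_compact hK (hf.mono hKU)
  obtain ⟨F, hF, hFf⟩ := hC.extend_real
  obtain ⟨D, hD⟩ := ContDiff.lipschitzWith_of_hasCompactSupport hgc hg (by norm_num)
  have h1 : ∀ x, lineDeriv ℝ f x v * g x = lineDeriv ℝ F x v * g x := by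
    intro x
    by_cases hx : x ∈ tsupport g
    · have : f =ᶠ[𝓝 x] F :=
        Filter.eventually_of_mem (mem_interior_iff_mem_nhds.1 (hgK hx)) hFf
      rw [this.lineDeriv_eq]
    · rw [image_eq_zero_of_notMem_tsupport hx, mul_zero, mul_zero]
  have h2 : ∀ x, lineDeriv ℝ g x (-v) * F x = -(f x * fderiv ℝ g x v) := by
    intro x
    rw [((hg.differentiable (by norm_num)) x).lineDeriv_eq_fderiv, map_neg]
    by_cases hx : x ∈ tsupport g
    · rw [hFf (interior_subset (hgK hx))]; ring
    · have : fderiv ℝ g x = 0 := by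
        by_contra h
        exact hx (support_fderiv_subset ℝ h)
      rw [this]; simp
  simp only [h1]
  refine ⟨?_, ?_⟩
  · have := (hF.locallyIntegrable_lineDeriv (μ := μ) v).integrable_smul_right_of_hasCompactSupport
      hg.continuous hgc
    simpa using this
  · rw [hF.integral_lineDeriv_mul_eq hD hgc v, ← integral_neg]
    simp only [h2]

omit [MeasurableSpace E] [BorelSpace E] in
/-- Near a linearly vanishing function `c`, the constant `1` is a combination of `c` and of its
directional derivatives. -/
theorem exists_fderiv_combination {U : Set E} (hU : IsOpen U) {c : E → ℝ}
    (hc : ContDiffOn ℝ ∞ c U) (hc' : ∀ x ∈ U, c x = 0 → fderiv ℝ c x ≠ 0) :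
    ∃ (m : ℕ) (v : Fin m → E) (a : Fin m → E → ℝ) (a₀ : E → ℝ),
      (∀ i, ContDiffOn ℝ ∞ (a i) U) ∧ ContDiffOn ℝ ∞ a₀ U ∧
      (∀ x ∈ U, ∑ i, a i x * fderiv ℝ c x (v i) + a₀ x * c x = 1) ∧
      ∀ x, 0 ≤ ∑ i, a i x * fderiv ℝ c x (v i) := by
  set b := Module.finBasis ℝ E
  -- $Q$ is nonzero on $U$ because $c$ and $dc$ have no common zero there. Dividing by it gives
  -- coefficients $\partial_ic/Q$ and $c/Q$, and makes the derivative part of the sum nonnegative.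
  set Q : E → ℝ := fun x => ∑ i, fderiv ℝ c x (b i) ^ 2 + c x ^ 2 with hQ
  have hd : ∀ v, ContDiffOn ℝ ∞ (fun x => fderiv ℝ c x v) U := fun v =>
    (hc.fderiv_of_isOpen hU (by norm_num)).clm_apply contDiffOn_const
  have hQd : ContDiffOn ℝ ∞ Q U := by
    refine ContDiffOn.add (ContDiffOn.sum fun i _ => (hd (b i)).pow 2) (hc.pow 2)
  have hQ0 : ∀ x, 0 ≤ Q x := fun x => by positivity
  have hQne : ∀ x ∈ U, Q x ≠ 0 := by
    intro x hx h
    have h1 : ∑ i, fderiv ℝ c x (b i) ^ 2 = 0 ∧ c x ^ 2 = 0 :=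
      (add_eq_zero_iff_of_nonneg (by positivity) (by positivity)).1 h
    refine hc' x hx (by simpa using h1.2) ?_
    have h2 := (Finset.sum_eq_zero_iff_of_nonneg fun i _ => by positivity).1 h1.1
    have : (fderiv ℝ c x : E →ₗ[ℝ] ℝ) = 0 := b.ext fun i => by
      simpa using h2 i (Finset.mem_univ i)
    ext v
    exact congrArg (fun f => f v) this
  refine ⟨_, b, fun i x => fderiv ℝ c x (b i) / Q x, fun x => c x / Q x,
    fun i => (hd (b i)).div hQd hQne, hc.div hQd hQne, fun x hx => ?_, fun x => ?_⟩
  · have e : ∀ i, fderiv ℝ c x (b i) / Q x * fderiv ℝ c x (b i) =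
        fderiv ℝ c x (b i) ^ 2 / Q x := fun i => by ring
    simp only [e]
    rw [← Finset.sum_div, div_mul_eq_mul_div, ← add_div, ← sq]
    exact div_self (hQne x hx)
  · refine Finset.sum_nonneg fun i _ => ?_
    rw [div_mul_eq_mul_div, ← sq]
    exact div_nonneg (sq_nonneg _) (hQ0 x)

/-- With $r=\sqrt{t^2+\varepsilon^2}$ one has $|t|\le r$, and $|r\log r|\le1$ when $r\le1$. The
point is that the bound is uniform in $\varepsilon$. -/
theorem abs_mul_log_sq_add_sq_le {t ε : ℝ} (hε : 0 < ε) (hε1 : ε ≤ 1) :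
    |t * Real.log (t ^ 2 + ε ^ 2)| ≤ 2 + |t| * (t ^ 2 + 1) := by
  have hs : 0 < t ^ 2 + ε ^ 2 := by positivity
  rw [abs_mul]
  rcases le_total 1 (t ^ 2 + ε ^ 2) with h | h
  · rw [abs_of_nonneg (Real.log_nonneg h)]
    have h1 : Real.log (t ^ 2 + ε ^ 2) ≤ t ^ 2 + 1 := by
      have := Real.log_le_sub_one_of_pos hs
      nlinarith
    nlinarith [abs_nonneg t, mul_le_mul_of_nonneg_left h1 (abs_nonneg t)]
  · set r := Real.sqrt (t ^ 2 + ε ^ 2) with hr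
    have hr0 : 0 < r := Real.sqrt_pos.2 hs
    have hrs : r ^ 2 = t ^ 2 + ε ^ 2 := Real.sq_sqrt hs.le
    have htr : |t| ≤ r := Real.abs_le_sqrt (by nlinarith)
    have hr1 : r ≤ 1 := by nlinarith
    rw [← hrs, Real.log_pow, abs_mul]
    have h2 : |Real.log r| * r ≤ 1 := by
      rw [abs_of_nonpos (Real.log_nonpos hr0.le hr1)]
      have := Real.one_sub_inv_le_log_of_pos hr0
      have h3 : r * (1 - r⁻¹) = r - 1 := by field_simp
      nlinarith
    have h3 : |t| * |Real.log r| ≤ 1 := by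
      nlinarith [abs_nonneg (Real.log r), mul_le_mul_of_nonneg_right htr (abs_nonneg (Real.log r))]
    have h4 : 0 ≤ |t| * (t ^ 2 + 1) := by positivity
    push_cast
    rw [abs_two]
    linarith

/-- The zero set of a linearly vanishing function is negligible, and the logarithm of the function
is locally integrable. -/
theorem measure_zero_and_integrableOn_log {U : Set E} (hU : IsOpen U) {c : E → ℝ}
    (hc : ContDiffOn ℝ ∞ c U) (hc' : ∀ x ∈ U, c x = 0 → fderiv ℝ c x ≠ 0) {K : Set E}
    (hK : IsCompact K) (hKU : K ⊆ U) :
    (∀ᵐ x ∂μ, x ∈ K → c x ≠ 0) ∧ IntegrableOn (fun x => Real.log (c x)) K μ := by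
  obtain ⟨m, v, a, a₀, ha, ha₀, hsum, hnn⟩ := exists_fderiv_combination hU hc hc'
  obtain ⟨K', hK', hKK', hK'U⟩ := exists_compact_between hK hU hKU
  obtain ⟨ψ, hψ1, hψ0, hψI⟩ := exists_contMDiffMap_one_nhds_of_subset_interior
    (n := (⊤ : ℕ∞)) 𝓘(ℝ, E) hK.isClosed hKK'
  have hψs : ContDiff ℝ ∞ ψ := ψ.contMDiff.contDiff
  have hψK : ∀ x ∈ K, ψ x = 1 := fun x hx => hψ1.self_of_nhdsSet x hx
  have hψt : tsupport ψ ⊆ K' :=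
    closure_minimal (fun x hx => by by_contra h; exact hx (hψ0 x h)) hK'.isClosed
  have hψc : HasCompactSupport ψ := hK'.of_isClosed_subset (isClosed_tsupport _) hψt
  have hψU : tsupport ψ ⊆ U := hψt.trans hK'U
  set w : E → ℝ := fun x => ψ x * ∑ i, a i x * fderiv ℝ c x (v i) with hw
  have hw0 : ∀ x, 0 ≤ w x := fun x => mul_nonneg (hψI x).1 (hnn x)
  obtain ⟨A, hA⟩ : ∃ A, ∀ x ∈ K', c x ^ 2 + 1 ≤ A := by
    obtain ⟨A, hA⟩ := (hK'.image_of_continuousOn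
      (f := fun x => c x ^ 2 + 1)
      (((hc.continuousOn.mono hK'U).pow 2).add continuousOn_const)).bddAbove
    exact ⟨A, fun x hx => hA (Set.mem_image_of_mem _ hx)⟩
  -- Chosen so that $D_\varepsilon(c)\ge0$ on the support of $\psi$ for $\varepsilon\le1$: there
  -- $\log(c^2+\varepsilon^2)\le\log A$, and the rational term of $D_\varepsilon$ is at most $2$.
  set M := 2 + Real.log A with hM
  set g : Fin m → E → ℝ := fun i x => ψ x * a i x with hg
  have hgs : ∀ i, ContDiff ℝ ∞ (g i) := fun i =>
    contDiff_mul_of_tsupport_subset hU hψs hψU (ha i)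
  have hgc : ∀ i, HasCompactSupport (g i) := fun i => hψc.mul_right (f' := a i)
  have hgU : ∀ i, tsupport (g i) ⊆ U := fun i => tsupport_mul_subset.trans hψU
  set B : ℝ := ∑ i, ∫ x, |fderiv ℝ (g i) x (v i)| *
    ((2 + |c x| * (c x ^ 2 + 1)) + |M| * |c x|) ∂μ with hB
  set D : ℝ → ℝ → ℝ := fun ε t =>
    -(Real.log (t ^ 2 + ε ^ 2) + t * ((2 * t) / (t ^ 2 + ε ^ 2))) + M with hD
  -- $\Phi_\varepsilon$ stays bounded on compact sets uniformly in $\varepsilon$, while its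
  -- derivative $D_\varepsilon$ tends to $-2\log|t|-2+M$ for $t\ne0$ and to $+\infty$ at $t=0$.
  -- Integration by parts thus bounds $\int w\,D_\varepsilon(c)$ by $B$.
  set Φ : ℝ → ℝ → ℝ := fun ε t => -(t * Real.log (t ^ 2 + ε ^ 2)) + M * t with hΦ
  have hΦD : ∀ ε, 0 < ε → ∀ t, HasDerivAt (Φ ε) (D ε t) t := by
    intro ε hε t
    have h1 : HasDerivAt (fun t : ℝ => t ^ 2 + ε ^ 2) (2 * t) t := by
      simpa using (hasDerivAt_pow 2 t).add_const (ε ^ 2)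
    have h2 := ((hasDerivAt_id t).mul (h1.log (by positivity))).neg.add
      ((hasDerivAt_id t).const_mul M)
    simpa [hΦ, hD] using! h2
  have hbdry : ∀ ε, 0 < ε → ε ≤ 1 → Integrable (fun x => w x * D ε (c x)) μ ∧
      ∫ x, w x * D ε (c x) ∂μ ≤ B := by
    intro ε hε hε1
    have hΦs : ContDiff ℝ 1 (Φ ε) := by
      refine ((contDiff_id.mul (ContDiff.log (by fun_prop) fun t => by positivity)).neg).add
        (contDiff_const.mul contDiff_id)
    have hLip : LocallyLipschitzOn U fun x => Φ ε (c x) :=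
      locallyLipschitzOn_of_contDiffOn hU
        (hΦs.comp_contDiffOn (hc.of_le (by norm_cast)))
    have hparts := fun i => integral_lineDeriv_mul_eq_neg μ hU hLip
      ((hgs i).of_le (by norm_cast)) (hgc i) (hgU i) (v i)
    have hder : ∀ i x, lineDeriv ℝ (fun x => Φ ε (c x)) x (v i) * g i x =
        ψ x * (a i x * fderiv ℝ c x (v i)) * D ε (c x) := by
      intro i x
      by_cases hx : x ∈ tsupport ψ
      · have hcd : HasFDerivAt c (fderiv ℝ c x) x :=
          ((hc.contDiffAt (hU.mem_nhds (hψU hx))).differentiableAt (by norm_num)).hasFDerivAt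
        have := ((hΦD ε hε (c x)).comp_hasFDerivAt x hcd).hasLineDerivAt (v i)
        have h2 : lineDeriv ℝ (fun x => Φ ε (c x)) x (v i) = D ε (c x) * fderiv ℝ c x (v i) := by
          simpa using! this.lineDeriv
        rw [h2]
        simp only [hg]
        ring
      · have h0 : ψ x = 0 := image_eq_zero_of_notMem_tsupport hx
        simp [hg, h0]
    have hwD : (fun x => w x * D ε (c x)) =
        fun x => ∑ i, lineDeriv ℝ (fun x => Φ ε (c x)) x (v i) * g i x := by
      funext x
      simp only [hder, hw]
      rw [← Finset.sum_mul, ← Finset.mul_sum]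
    refine ⟨?_, ?_⟩
    · rw [hwD]
      exact integrable_finsetSum _ fun i _ => (hparts i).1
    · rw [hwD, integral_finsetSum _ fun i _ => (hparts i).1]
      refine Finset.sum_le_sum fun i _ => ?_
      rw [(hparts i).2, ← integral_neg]
      have hfd : Continuous fun x => fderiv ℝ (g i) x (v i) :=
        ((hgs i).continuous_fderiv (by norm_num)).clm_apply continuous_const
      have hfc : HasCompactSupport fun x => fderiv ℝ (g i) x (v i) :=
        (hgc i).fderiv_apply ℝ (v i)
      have hft : (tsupport fun x => fderiv ℝ (g i) x (v i)) ⊆ U :=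
        (tsupport_fderiv_apply_subset ℝ (v i)).trans (hgU i)
      have hcc := hc.continuousOn
      refine integral_mono ?_ ?_ fun x => ?_
      · have := integrable_mul_of_tsupport_subset μ hU hfd hfc hft
          (k := fun x => Φ ε (c x)) (hΦs.continuous.comp_continuousOn hcc)
        refine this.neg.congr (Eventually.of_forall fun x => ?_)
        simp only [Pi.neg_apply]
        ring
      · refine integrable_mul_of_tsupport_subset μ hU hfd.abs (hfc.comp_left abs_zero) ?_ ?_
        · exact (closure_mono fun x hx => by simpa using hx).trans hft
        · fun_prop
      · refine (neg_le_abs _).trans ?_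
        rw [abs_mul, mul_comm]
        gcongr
        refine (abs_add_le _ _).trans ?_
        rw [abs_neg, abs_mul M]
        gcongr
        exact abs_mul_log_sq_add_sq_le hε hε1
  have hDnn : ∀ ε, 0 < ε → ε ≤ 1 → ∀ x, 0 ≤ w x * D ε (c x) := by
    intro ε hε hε1 x
    by_cases hx : x ∈ tsupport ψ
    · refine mul_nonneg (hw0 x) ?_
      have hs : 0 < c x ^ 2 + ε ^ 2 := by positivity
      have h1 : Real.log (c x ^ 2 + ε ^ 2) ≤ Real.log A := by
        refine Real.log_le_log hs (le_trans ?_ (hA x (hψt hx)))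
        nlinarith
      have h2 : c x * (2 * c x / (c x ^ 2 + ε ^ 2)) ≤ 2 := by
        rw [← mul_div_assoc, div_le_iff₀ hs]
        nlinarith [sq_nonneg ε]
      simp only [hD, hM]
      linarith
    · have h0 : ψ x = 0 := image_eq_zero_of_notMem_tsupport hx
      simp [hw, h0]
  set e : ℕ → ℝ := fun k => 1 / ((k : ℝ) + 1) with he
  have he0 : ∀ k, 0 < e k := fun k => by positivity
  have he1 : ∀ k, e k ≤ 1 := fun k => by
    rw [he]; simp only; rw [div_le_one (by positivity)]; linarith [k.cast_nonneg (α := ℝ)]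
  have hetend : Tendsto e atTop (𝓝 0) := tendsto_one_div_add_atTop_nhds_zero_nat
  set G : ℕ → E → ENNReal := fun k x => ENNReal.ofReal (w x * D (e k) (c x)) with hG
  -- The finite bound forces the lower limit to be finite almost everywhere. At a zero of $c$ in $K$
  -- it is infinite, since $w=1$ there, so these zeros are null; elsewhere on $K$ it controls
  -- $w\log|c|$.
  have hfatou : ∫⁻ x, liminf (fun k => G k x) atTop ∂μ ≤ ENNReal.ofReal B := by
    refine (lintegral_liminf_le' fun k =>
      (hbdry _ (he0 k) (he1 k)).1.1.aemeasurable.ennreal_ofReal).trans ?_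
    refine liminf_le_of_le (by isBoundedDefault) fun b hb => ?_
    obtain ⟨k, hk⟩ := hb.exists
    refine hk.trans ?_
    rw [← ofReal_integral_eq_lintegral_ofReal (hbdry _ (he0 k) (he1 k)).1
      (Eventually.of_forall (hDnn _ (he0 k) (he1 k)))]
    exact ENNReal.ofReal_le_ofReal (hbdry _ (he0 k) (he1 k)).2
  have hDc : ∀ ε, 0 < ε → Continuous (D ε) := by
    intro ε hε
    have h0 : ∀ t : ℝ, t ^ 2 + ε ^ 2 ≠ 0 := fun t => by positivity
    exact ((Continuous.log (by fun_prop) h0).add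
      (continuous_id.mul (Continuous.div (by fun_prop) (by fun_prop) h0))).neg.add continuous_const
  have hsumc : ContinuousOn (fun x => ∑ i, a i x * fderiv ℝ c x (v i)) U :=
    continuousOn_finsetSum _ fun i _ => (ha i).continuousOn.mul
      ((hc.continuousOn_fderiv_of_isOpen hU (by norm_num)).clm_apply continuousOn_const)
  have hGm : Measurable (fun x => liminf (fun k => G k x) atTop) := by
    refine Measurable.liminf fun k => ?_
    have h1 : Continuous fun x => w x * D (e k) (c x) := by
      have := continuous_mul_of_tsupport_subset hU hψs.continuous hψU
        (k := fun x => (∑ i, a i x * fderiv ℝ c x (v i)) * D (e k) (c x))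
        (hsumc.mul ((hDc _ (he0 k)).comp_continuousOn hc.continuousOn))
      refine this.congr fun x => ?_
      simp only [hw]
      ring
    exact h1.measurable.ennreal_ofReal
  have hfin := ae_lt_top hGm (hfatou.trans_lt ENNReal.ofReal_lt_top).ne
  have hne : ∀ᵐ x ∂μ, x ∈ K → c x ≠ 0 := by
    filter_upwards [hfin] with x hx hxK hcx
    have hwx : w x = 1 := by
      have := hsum x (hKU hxK)
      rw [hcx, mul_zero, add_zero] at this
      simp only [hw, this, hψK x hxK, one_mul]
    have : Tendsto (fun k => G k x) atTop (𝓝 ⊤) := by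
      simp only [hG, hwx, hcx, one_mul, hD]
      refine ENNReal.tendsto_ofReal_atTop.comp ?_
      have h1 : Tendsto (fun k => Real.log (e k)) atTop atBot :=
        Real.tendsto_log_nhdsGT_zero.comp
          (tendsto_nhdsWithin_iff.2 ⟨hetend, Eventually.of_forall fun k => he0 k⟩)
      have h2 : Tendsto (fun k => -(2 * Real.log (e k)) + M) atTop atTop :=
        tendsto_atTop_add_const_right _ _
          (tendsto_neg_atBot_atTop.comp (h1.const_mul_atBot (by norm_num)))
      refine h2.congr fun k => ?_
      simp [Real.log_pow]
    rw [this.liminf_eq] at hx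
    exact lt_irrefl _ hx
  refine ⟨hne, ?_⟩
  have hcK : ContinuousOn c K := hc.continuousOn.mono hKU
  have hKm : MeasurableSet K := hK.isClosed.measurableSet
  have hlim : ∀ x, x ∈ K → c x ≠ 0 → liminf (fun k => G k x) atTop =
      ENNReal.ofReal (w x * (-(2 * Real.log (c x) + 2) + M)) := by
    intro x _ hcx
    have hcx2 : c x ^ 2 + 0 ^ 2 ≠ 0 := by simpa using hcx
    have h1 : Tendsto (fun k => c x ^ 2 + e k ^ 2) atTop (𝓝 (c x ^ 2 + 0 ^ 2)) :=
      (hetend.pow 2).const_add _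
    have h2 : Tendsto (fun k => D (e k) (c x)) atTop (𝓝 (-(2 * Real.log (c x) + 2) + M)) := by
      have := (((h1.log hcx2).add
        (((tendsto_const_nhds (x := 2 * c x)).div h1 hcx2).const_mul (c x))).neg).add_const M
      have e2 : -(Real.log (c x ^ 2 + 0 ^ 2) + c x * (2 * c x / (c x ^ 2 + 0 ^ 2))) + M =
          -(2 * Real.log (c x) + 2) + M := by
        simp only [ne_eq, OfNat.ofNat_ne_zero, not_false_eq_true, zero_pow, add_zero, Real.log_pow]
        field_simp
        norm_num
        ring
      rw [e2] at this
      exact this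
    exact (ENNReal.tendsto_ofReal (h2.const_mul (w x))).liminf_eq
  have hwc : ContinuousOn w K := hψs.continuous.continuousOn.mul (hsumc.mono hKU)
  have hlogm : AEStronglyMeasurable (fun x => Real.log (c x)) (μ.restrict K) :=
    (Real.measurable_log.comp_aemeasurable (hcK.aemeasurable hKm)).aestronglyMeasurable
  have hint1 : IntegrableOn (fun x => w x * (-(2 * Real.log (c x) + 2) + M)) K μ := by
    refine ⟨(hwc.aestronglyMeasurable hKm).mul (by fun_prop), ?_⟩
    have hnn' : 0 ≤ᵐ[μ.restrict K] fun x => w x * (-(2 * Real.log (c x) + 2) + M) := by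
      filter_upwards [ae_restrict_of_ae hne, ae_restrict_mem hKm] with x hx hxK
      refine mul_nonneg (hw0 x) ?_
      have h1 : 2 * Real.log (c x) ≤ Real.log A := by
        have h2 : 2 * Real.log (c x) = Real.log (c x ^ 2) := by simp [Real.log_pow]
        rw [h2]
        have := sq_pos_of_ne_zero (hx hxK)
        refine Real.log_le_log this (le_trans ?_ (hA x (interior_subset (hKK' hxK))))
        linarith
      rw [hM]
      linarith
    rw [hasFiniteIntegral_iff_ofReal hnn']
    refine lt_of_le_of_lt ?_ (hfatou.trans_lt ENNReal.ofReal_lt_top)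
    refine le_trans (le_of_eq (lintegral_congr_ae ?_)) (setLIntegral_le_lintegral K _)
    filter_upwards [ae_restrict_of_ae hne, ae_restrict_mem hKm] with x hx hxK
    rw [hlim x hxK (hx hxK)]
  have hint2 : IntegrableOn (fun x => a₀ x * (c x * Real.log (c x))) K μ :=
    ((ha₀.continuousOn.mono hKU).mul
      (Real.continuous_mul_log.comp_continuousOn hcK)).integrableOn_compact hK
  have hint3 : IntegrableOn (fun x => w x * (M - 2)) K μ :=
    (hwc.mul continuousOn_const).integrableOn_compact hK
  -- On $K$, $1=w+a_0c$, so $\log|c|=w\log|c|+a_0\,c\log|c|$; the second term is continuous.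
  have hall := (((hint3.sub hint1).const_mul (1 / 2)).add hint2)
  refine IntegrableOn.congr_fun hall (fun x hx => ?_) hKm
  have h1 := hsum x (hKU hx)
  have h2 : w x = ∑ i, a i x * fderiv ℝ c x (v i) := by simp [hw, hψK x hx]
  rw [← h2] at h1
  simp only [Pi.add_apply, Pi.sub_apply]
  linear_combination Real.log (c x) * h1

/-- Level sets of a function without critical points on them are negligible. -/
theorem measure_level_eq_zero {U : Set E} (hU : IsOpen U) {h : E → ℝ} (hh : ContDiffOn ℝ ∞ h U)
    {K : Set E} (hK : IsCompact K) (hKU : K ⊆ U) (t : ℝ)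
    (hh' : ∀ x ∈ K, h x = t → fderiv ℝ h x ≠ 0) : ∀ᵐ x ∂μ, x ∈ K → h x ≠ t := by
  have hfd := hh.continuousOn_fderiv_of_isOpen hU (by norm_num)
  -- Once the critical points are removed, $h-t$ vanishes linearly and the result on zero sets
  -- applies to it.
  have hU' : IsOpen (U ∩ fderiv ℝ h ⁻¹' {0}ᶜ) := hfd.isOpen_inter_preimage hU isOpen_compl_singleton
  have hK' : IsCompact (K ∩ h ⁻¹' {t}) :=
    hK.of_isClosed_subset ((hh.continuousOn.mono hKU).preimage_isClosed_of_isClosed hK.isClosed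
      isClosed_singleton) Set.inter_subset_left
  have := (measure_zero_and_integrableOn_log μ hU' (c := fun x => h x - t)
    ((hh.mono Set.inter_subset_left).sub contDiffOn_const)
    (fun x hx _ => by rw [fderiv_sub_const]; exact hx.2) hK'
    (fun x hx => ⟨hKU hx.1, hh' x hx.1 hx.2⟩)).1
  filter_upwards [this] with x hx hxK hxt
  exact hx ⟨hxK, hxt⟩ (sub_eq_zero.2 hxt)

end Integration

/-! ### Truncated integrals and their limits in Euclidean space -/

section Truncation

/-- The part of the support of $g$ where $|h|\ge\varepsilon$ is compact and avoids the zeros of $h$,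
so the integrand is continuous on it. -/
theorem integrable_indicator_mul {E : Type*} [NormedAddCommGroup E] [MeasurableSpace E]
    [BorelSpace E] (μ : Measure E) [IsFiniteMeasureOnCompacts μ] {U : Set E} {g h k : E → ℝ}
    (hg : Continuous g) (hgc : HasCompactSupport g) (hgU : tsupport g ⊆ U)
    (hh : ContinuousOn h U) (hk : ContinuousOn k (U ∩ {x | h x ≠ 0})) {ε : ℝ} (hε : 0 < ε) :
    Integrable ({x | ε ≤ |h x|}.indicator fun x => g x * k x) μ := by
  have hS : IsCompact (tsupport g ∩ (fun x => |h x|) ⁻¹' Set.Ici ε) :=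
    hgc.of_isClosed_subset ((hh.mono hgU).abs.preimage_isClosed_of_isClosed
      (isClosed_tsupport g) isClosed_Ici) Set.inter_subset_left
  have h1 : IntegrableOn (fun x => g x * k x) (tsupport g ∩ (fun x => |h x|) ⁻¹' Set.Ici ε) μ := by
    refine ContinuousOn.integrableOn_compact hS (hg.continuousOn.mul (hk.mono ?_))
    rintro x ⟨hx, hx'⟩
    exact ⟨hgU hx, abs_pos.1 (hε.trans_le hx')⟩
  refine ((integrable_indicator_iff hS.isClosed.measurableSet).2 h1).congr
    (Eventually.of_forall fun x => ?_)
  by_cases hx : x ∈ tsupport g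
  · by_cases hx' : ε ≤ |h x| <;> simp [Set.indicator, hx, hx']
  · simp [Set.indicator, image_eq_zero_of_notMem_tsupport hx]

variable {E : Type*} [NormedAddCommGroup E] [NormedSpace ℝ E] [FiniteDimensional ℝ E]
  [MeasurableSpace E] [BorelSpace E] (μ : Measure E) [μ.IsAddHaarMeasure]

omit [NormedSpace ℝ E] [FiniteDimensional ℝ E] [MeasurableSpace E] [BorelSpace E] in
theorem locallyLipschitzOn_log_max {U : Set E} (hU : IsOpen U) {h : E → ℝ}
    (hh : LocallyLipschitzOn U h) {ε : ℝ} (hε : 0 < ε) :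
    LocallyLipschitzOn U fun x => Real.log (max |h x| ε) := by
  refine locallyLipschitzOn_log hU (f := fun x => max |h x| ε)
    (locallyLipschitzOn_comp hU (φ := fun t => max |t| ε) hh fun x _ => ?_) fun x _ => ?_
  · refine ⟨1, Set.univ, univ_mem, LipschitzOnWith.of_dist_le_mul fun s _ t _ => ?_⟩
    rw [NNReal.coe_one, one_mul, Real.dist_eq, Real.dist_eq]
    exact (abs_max_sub_max_le_abs _ _ _).trans (abs_abs_sub_abs_le _ _)
  · exact (hε.trans_le (le_max_right _ _)).ne'

/-- The regularized integral of a logarithmic derivative, truncated by any function that vanishes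
linearly on the same set. -/
theorem tendsto_integral_indicator_fderiv_div {U : Set E} (hU : IsOpen U) {c h g : E → ℝ}
    (hc : ContDiffOn ℝ ∞ c U) (hh : ContDiffOn ℝ ∞ h U) (h0 : ∀ x ∈ U, h x = 0 ↔ c x = 0)
    (hc' : ∀ x ∈ U, c x = 0 → fderiv ℝ c x ≠ 0) (hh' : ∀ x ∈ U, h x = 0 → fderiv ℝ h x ≠ 0)
    (hg : ContDiff ℝ ∞ g) (hgc : HasCompactSupport g) (hgU : tsupport g ⊆ U) (v : E) :
    Tendsto (fun ε : ℝ => ∫ x, {x | ε ≤ |h x|}.indicator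
        (fun x => g x * (fderiv ℝ c x v / c x)) x ∂μ) (𝓝[>] 0)
      (𝓝 (-∫ x, Real.log (c x) * fderiv ℝ g x v ∂μ)) := by
  obtain ⟨u, hu, huc⟩ := exists_locallyLipschitzOn_quotient hU hc hh h0 hc' hh'
  set K := tsupport g with hK
  have hKc : IsCompact K := hgc
  have hg1 : ContDiff ℝ 1 g := hg.of_le (by norm_cast)
  have hlogu := locallyLipschitzOn_log hU hu fun x hx => (huc x hx).1
  set F : ℝ → E → ℝ := fun ε x => Real.log (max |h x| ε) - Real.log (u x) with hF
  have hFL : ∀ ε, 0 < ε → LocallyLipschitzOn U (F ε) := fun ε hε =>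
    (locallyLipschitzOn_log_max hU
      (locallyLipschitzOn_of_contDiffOn hU (hh.of_le (by norm_cast))) hε).sub hlogu
  obtain ⟨hne, hlog⟩ := measure_zero_and_integrableOn_log μ hU hc hc' hKc hgU
  have hpu := (integral_lineDeriv_mul_eq_neg μ hU hlogu hg1 hgc hgU v).1
  have hpF := fun ε hε => integral_lineDeriv_mul_eq_neg μ hU (hFL ε hε) hg1 hgc hgU v
  set S : ℝ → Set E := fun ε => U ∩ {x | |h x| < ε} with hS
  have hSo : ∀ ε, IsOpen (S ε) := fun ε =>
    hh.continuousOn.abs.isOpen_inter_preimage hU isOpen_Iio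
  have hFc : ∀ ε, ∀ x ∈ U, ε ≤ |h x| → 0 < ε → F ε x = Real.log (c x) := by
    intro ε x hx hεx hε
    have hhx : h x ≠ 0 := abs_pos.1 (hε.trans_le hεx)
    have hcx : c x ≠ 0 := fun h => hhx ((h0 x hx).2 h)
    simp only [hF]
    rw [max_eq_left hεx, Real.log_abs, (huc x hx).2, Real.log_mul (huc x hx).1 hcx]
    ring
  -- The critical points of $h$ in $K$ form a compact set on which $|h|$ is positive, hence bounded
  -- below. For small $\varepsilon$ the levels $\pm\varepsilon$, where $F_\varepsilon$ has its kink,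
  -- are therefore null in $K$.
  obtain ⟨ε₀, hε₀, hcrit⟩ : ∃ ε₀ : ℝ, 0 < ε₀ ∧ ∀ x ∈ K, |h x| < ε₀ → fderiv ℝ h x ≠ 0 := by
    have hfd := hh.continuousOn_fderiv_of_isOpen hU (by norm_num)
    have hC : IsCompact (K ∩ fderiv ℝ h ⁻¹' {0}) :=
      hKc.of_isClosed_subset ((hfd.mono hgU).preimage_isClosed_of_isClosed
        (isClosed_tsupport g) isClosed_singleton) Set.inter_subset_left
    obtain ⟨ε₀, hε₀, H⟩ := hC.exists_forall_le' (f := fun x => |h x|) (a := 0)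
      (hh.continuousOn.abs.mono (Set.inter_subset_left.trans hgU))
      (fun x hx => abs_pos.2 fun h => hh' x (hgU hx.1) h hx.2)
    exact ⟨ε₀, hε₀, fun x hx hlt h => (H x ⟨hx, h⟩).not_gt hlt⟩
  -- The second integral cancels the derivative $-\partial_v\log|u|$ that $F_\varepsilon$ has inside
  -- $\{|h|<\varepsilon\}$.
  have hidentity : ∀ ε ∈ Set.Ioo 0 ε₀,
      ∫ x, {x | ε ≤ |h x|}.indicator (fun x => g x * (fderiv ℝ c x v / c x)) x ∂μ =
        -(∫ x, F ε x * fderiv ℝ g x v ∂μ) +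
        ∫ x, (S ε).indicator (fun x => lineDeriv ℝ (fun x => Real.log (u x)) x v * g x) x ∂μ := by
    rintro ε ⟨hε, hεlt⟩
    have hlev : ∀ t, |t| = ε → ∀ᵐ x ∂μ, x ∈ K → h x ≠ t := fun t ht =>
      measure_level_eq_zero μ hU hh hKc hgU t fun x hx hxt => hcrit x hx (by rw [hxt, ht]; exact hεlt)
    rw [← (hpF ε hε).2, ← integral_add (hpF ε hε).1 (hpu.indicator (hSo ε).measurableSet)]
    refine integral_congr_ae ?_
    filter_upwards [hlev ε (abs_of_pos hε), hlev (-ε) (by rw [abs_neg, abs_of_pos hε])]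
      with x hx1 hx2
    by_cases hx : x ∈ K
    · have hxU := hgU hx
      have hhc : ContinuousAt h x := hh.continuousOn.continuousAt (hU.mem_nhds hxU)
      rcases lt_trichotomy |h x| ε with hlt | heq | hgt
      · have h1 : x ∈ S ε := ⟨hxU, hlt⟩
        have h2 : x ∉ {x | ε ≤ |h x|} := not_le.2 hlt
        have h3 : F ε =ᶠ[𝓝 x] fun y => Real.log ε - Real.log (u y) := by
          filter_upwards [(hSo ε).mem_nhds h1] with y hy
          simp only [hF]
          rw [max_eq_right (le_of_lt hy.2)]
        rw [Set.indicator_of_notMem h2, Set.indicator_of_mem h1, h3.lineDeriv_eq]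
        simp [lineDeriv]
      · exfalso
        rcases eq_or_eq_neg_of_abs_eq heq with h | h
        · exact hx1 hx h
        · exact hx2 hx h
      · have h1 : x ∉ S ε := fun h => hgt.not_gt h.2
        have h2 : x ∈ {x | ε ≤ |h x|} := hgt.le
        have hcx : c x ≠ 0 := fun h => by
          rw [(h0 x hxU).2 h, abs_zero] at hgt; exact hgt.not_gt hε
        have h3 : F ε =ᶠ[𝓝 x] fun y => Real.log (c y) := by
          filter_upwards [hU.mem_nhds hxU, hhc.abs.eventually (lt_mem_nhds hgt)] with y hyU hy
          exact hFc ε y hyU (le_of_lt hy) hε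
        have h4 : HasFDerivAt (fun y => Real.log (c y)) ((c x)⁻¹ • fderiv ℝ c x) x :=
          (((hc.contDiffAt (hU.mem_nhds hxU)).differentiableAt (by norm_num)).hasFDerivAt).log hcx
        rw [Set.indicator_of_mem h2, Set.indicator_of_notMem h1, h3.lineDeriv_eq,
          (h4.hasLineDerivAt v).lineDeriv]
        simp
        ring
    · have : g x = 0 := image_eq_zero_of_notMem_tsupport hx
      simp [Set.indicator, this]
  have hfd : Continuous fun x => fderiv ℝ g x v :=
    (hg.continuous_fderiv (by norm_num)).clm_apply continuous_const
  have hft : (tsupport fun x => fderiv ℝ g x v) ⊆ K := tsupport_fderiv_apply_subset ℝ v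
  have hf0 : ∀ x ∉ K, fderiv ℝ g x v = 0 := fun x hx =>
    image_eq_zero_of_notMem_tsupport (f := fun x => fderiv ℝ g x v) fun h => hx (hft h)
  have hlim1 : Tendsto (fun ε => ∫ x, F ε x * fderiv ℝ g x v ∂μ) (𝓝[>] 0)
      (𝓝 (∫ x, Real.log (c x) * fderiv ℝ g x v ∂μ)) := by
    refine tendsto_integral_filter_of_dominated_convergence
      (fun x => (|Real.log (c x)| + |Real.log (u x)|) * |fderiv ℝ g x v|) ?_ ?_ ?_ ?_
    · filter_upwards [self_mem_nhdsWithin] with ε hε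
      have := continuous_mul_of_tsupport_subset hU hfd (hft.trans hgU) (hFL ε hε).continuousOn
      simp only [mul_comm] at this
      exact this.aestronglyMeasurable
    · filter_upwards [self_mem_nhdsWithin, nhdsWithin_le_nhds (Iio_mem_nhds zero_lt_one)]
        with ε hε hε1
      filter_upwards [hne] with x hx
      by_cases hxK : x ∈ K
      · rw [norm_mul, Real.norm_eq_abs, Real.norm_eq_abs]
        gcongr
        have hxU := hgU hxK
        rcases le_or_gt ε |h x| with hle | hlt
        · rw [hFc ε x hxU hle hε]
          linarith [abs_nonneg (Real.log (u x))]
        -- For $|h|<\varepsilon<1$ one has $\log|h|\le\log\varepsilon\le0$, so $F_\varepsilon$ lies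
        -- between $\log|c|$ and $-\log|u|$. This gives a dominating function independent of
        -- $\varepsilon$.
        · have h1 : F ε x = Real.log ε - Real.log (u x) := by
            simp only [hF]; rw [max_eq_right hlt.le]
          have h2 : Real.log ε ≤ 0 := Real.log_nonpos (le_of_lt hε) (le_of_lt hε1)
          have h3 : Real.log (c x) + Real.log (u x) ≤ Real.log ε := by
            rw [add_comm, ← Real.log_mul (huc x hxU).1 (hx hxK), ← (huc x hxU).2, ← Real.log_abs]
            refine Real.log_le_log (abs_pos.2 fun h => hx hxK ((h0 x hxU).1 h)) hlt.le
          rw [h1, abs_le]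
          constructor
          · linarith [neg_abs_le (Real.log (c x)), abs_nonneg (Real.log (u x))]
          · linarith [neg_abs_le (Real.log (u x)), abs_nonneg (Real.log (c x))]
      · simp [hf0 x hxK]
    · have h1 : IntegrableOn (fun x => (|Real.log (c x)| + |Real.log (u x)|) * |fderiv ℝ g x v|)
          K μ := by
        refine IntegrableOn.mul_continuousOn (hlog.abs.add ?_) hfd.abs.continuousOn hKc
        exact ((hlogu.continuousOn.mono hgU).abs).integrableOn_compact hKc
      refine (integrableOn_iff_integrable_of_support_subset fun x hx => ?_).1 h1
      by_contra hxK
      exact hx (by simp [hf0 x hxK])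
    · filter_upwards [hne] with x hx
      by_cases hxK : x ∈ K
      · refine tendsto_const_nhds.congr' ?_
        have hhx : 0 < |h x| := abs_pos.2 fun h => hx hxK ((h0 x (hgU hxK)).1 h)
        filter_upwards [self_mem_nhdsWithin, nhdsWithin_le_nhds (Iio_mem_nhds hhx)] with ε hε hεx
        rw [hFc ε x (hgU hxK) (le_of_lt hεx) hε]
      · simp [hf0 x hxK]
  -- The derivative of $\log|u|$ times $g$ is integrable, and the sets $\{|h|<\varepsilon\}$ shrink
  -- to the null zero set.
  have hlim2 : Tendsto (fun ε => ∫ x, (S ε).indicator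
      (fun x => lineDeriv ℝ (fun x => Real.log (u x)) x v * g x) x ∂μ) (𝓝[>] 0) (𝓝 0) := by
    have := tendsto_integral_filter_of_dominated_convergence (μ := μ) (l := 𝓝[>] (0 : ℝ))
      (F := fun ε => (S ε).indicator
        (fun x => lineDeriv ℝ (fun x => Real.log (u x)) x v * g x)) (f := fun _ => 0)
      (fun x => ‖lineDeriv ℝ (fun x => Real.log (u x)) x v * g x‖)
      (Eventually.of_forall fun ε => (hpu.indicator (hSo ε).measurableSet).1)
      (Eventually.of_forall fun ε => Eventually.of_forall fun x => norm_indicator_le_norm_self _ _)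
      hpu.norm ?_
    · simpa using this
    · filter_upwards [hne] with x hx
      by_cases hxK : x ∈ K
      · refine tendsto_const_nhds.congr' ?_
        have hhx : 0 < |h x| := abs_pos.2 fun h => hx hxK ((h0 x (hgU hxK)).1 h)
        filter_upwards [nhdsWithin_le_nhds (Iio_mem_nhds hhx)] with ε hεx
        rw [Set.indicator_of_notMem fun hS => lt_asymm (show |h x| < ε from hS.2) hεx]
      · have : g x = 0 := image_eq_zero_of_notMem_tsupport hxK
        simp [Set.indicator, this]
  have := hlim1.neg.add hlim2
  rw [add_zero] at this
  refine this.congr' ?_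
  filter_upwards [Ioo_mem_nhdsGT hε₀] with ε hε
  rw [hidentity ε hε]

/-- The regularized integral of `f / c` exists and does not depend on the truncating function. -/
theorem exists_tendsto_integral_indicator_div {U : Set E} (hU : IsOpen U) {c f : E → ℝ}
    (hc : ContDiffOn ℝ ∞ c U) (hc' : ∀ x ∈ U, c x = 0 → fderiv ℝ c x ≠ 0)
    (hf : ContDiff ℝ ∞ f) (hfc : HasCompactSupport f) (hfU : tsupport f ⊆ U) :
    ∃ V : ℝ, ∀ h : E → ℝ, ContDiffOn ℝ ∞ h U → (∀ x ∈ U, h x = 0 ↔ c x = 0) →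
      (∀ x ∈ U, h x = 0 → fderiv ℝ h x ≠ 0) →
      Tendsto (fun ε : ℝ => ∫ x, {x | ε ≤ |h x|}.indicator (fun x => f x * (c x)⁻¹) x ∂μ)
        (𝓝[>] 0) (𝓝 V) := by
  obtain ⟨m, v, a, a₀, ha, ha₀, hsum, -⟩ := exists_fderiv_combination hU hc hc'
  have hga := fun i => contDiff_mul_of_tsupport_subset hU hf hfU (ha i)
  have hgac : ∀ i, HasCompactSupport fun x => f x * a i x := fun i => hfc.mul_right (f' := a i)
  have hgaU : ∀ i, (tsupport fun x => f x * a i x) ⊆ U := fun i => tsupport_mul_subset.trans hfU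
  -- The limit is written in terms of $c$, $f$ and the coefficients only, before any $h$ is
  -- introduced; this is the independence of $h$.
  refine ⟨∑ i, -∫ x, Real.log (c x) * fderiv ℝ (fun x => f x * a i x) x (v i) ∂μ +
    ∫ x, f x * a₀ x ∂μ, fun h hh h0 hh' => ?_⟩
  obtain ⟨hne, -⟩ := measure_zero_and_integrableOn_log μ hU hc hc' (K := tsupport f) hfc hfU
  have hlim := fun i => tendsto_integral_indicator_fderiv_div μ hU hc hh h0 hc' hh'
    (hga i) (hgac i) (hgaU i) (v i)
  have hint0 : ∀ ε : ℝ, 0 < ε → Integrable ({x | ε ≤ |h x|}.indicator fun x => f x * a₀ x) μ :=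
    fun ε hε => integrable_indicator_mul μ hf.continuous hfc hfU hh.continuousOn
      (ha₀.continuousOn.mono Set.inter_subset_left) hε
  have hlim0 : Tendsto (fun ε : ℝ => ∫ x, {x | ε ≤ |h x|}.indicator (fun x => f x * a₀ x) x ∂μ)
      (𝓝[>] 0) (𝓝 (∫ x, f x * a₀ x ∂μ)) := by
    refine tendsto_integral_filter_of_dominated_convergence (fun x => ‖f x * a₀ x‖) ?_
      (Eventually.of_forall fun ε => Eventually.of_forall fun x => norm_indicator_le_norm_self _ _)
      (integrable_mul_of_tsupport_subset μ hU hf.continuous hfc hfU ha₀.continuousOn).norm ?_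
    · filter_upwards [self_mem_nhdsWithin] with ε hε using (hint0 ε hε).1
    · filter_upwards [hne] with x hx
      by_cases hxK : x ∈ tsupport f
      · refine tendsto_const_nhds.congr' ?_
        have hhx : 0 < |h x| := abs_pos.2 fun h => hx hxK ((h0 x (hfU hxK)).1 h)
        filter_upwards [nhdsWithin_le_nhds (Iio_mem_nhds hhx)] with ε hεx
        rw [Set.indicator_of_mem]
        exact le_of_lt (show ε < |h x| from hεx)
      · simp [Set.indicator, image_eq_zero_of_notMem_tsupport hxK]
  refine ((tendsto_finsetSum _ fun i _ => hlim i).add hlim0).congr' ?_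
  filter_upwards [self_mem_nhdsWithin] with ε hε
  have hint : ∀ i, Integrable ({x | ε ≤ |h x|}.indicator
      fun x => f x * a i x * (fderiv ℝ c x (v i) / c x)) μ := fun i => by
    refine integrable_indicator_mul μ (hga i).continuous (hgac i) (hgaU i) hh.continuousOn ?_ hε
    refine ContinuousOn.div (((hc.continuousOn_fderiv_of_isOpen hU (by norm_num)).clm_apply
      continuousOn_const).mono Set.inter_subset_left)
      (hc.continuousOn.mono Set.inter_subset_left) ?_
    rintro x ⟨hxU, hx⟩ hcx
    exact hx ((h0 x hxU).2 hcx)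
  rw [← integral_finsetSum _ fun i _ => hint i,
    ← integral_add (integrable_finsetSum _ fun i _ => hint i) (hint0 ε hε)]
  congr 1
  funext x
  by_cases hx : x ∈ {x | ε ≤ |h x|}
  · simp only [Set.indicator_of_mem hx]
    by_cases hxK : x ∈ tsupport f
    · have hcx : c x ≠ 0 := fun h => by
        have h1 : ε ≤ |_| := hx
        rw [(h0 x (hfU hxK)).2 h, abs_zero] at h1
        exact h1.not_gt hε
      have e : ∀ i, f x * a i x * (fderiv ℝ c x (v i) / c x) =
          f x * (c x)⁻¹ * (a i x * fderiv ℝ c x (v i)) := fun i => by ring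
      simp only [e]
      rw [← Finset.mul_sum]
      have h2 := hsum x (hfU hxK)
      have h3 : f x * a₀ x = f x * (c x)⁻¹ * (a₀ x * c x) := by field_simp
      rw [h3, ← mul_add, h2, mul_one]
    · simp [image_eq_zero_of_notMem_tsupport hxK]
  · simp [Set.indicator_of_notMem hx]

end Truncation

/-! ### Forms and $n$-vectors evaluated on dual frames -/

section DualFrames

variable {n : ℕ} {θ θ' : Fin n → (Model n →L[ℝ] ℝ)} {w : Fin n → Model n}

theorem covector_matrix_eq_mul (θ : Fin n → (Model n →L[ℝ] ℝ)) (v : Fin n → Model n) :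
    (Matrix.of fun i j => θ i (v j)) =
      (Matrix.of fun i k => θ i ((EuclideanSpace.basisFun (Fin n) ℝ).toBasis k)) *
        (EuclideanSpace.basisFun (Fin n) ℝ).toBasis.toMatrix v := by
  ext i j
  set b := (EuclideanSpace.basisFun (Fin n) ℝ).toBasis
  simp only [Matrix.of_apply, Matrix.mul_apply, Module.Basis.toMatrix_apply]
  conv_lhs => rw [← b.sum_repr (v j)]
  simp only [map_sum, map_smul, smul_eq_mul]
  exact Finset.sum_congr rfl fun k _ => mul_comm _ _

/-- Change of frame for a form of top degree. -/
theorem form_apply_eq_det_mul (hθ : (Matrix.of fun i j => θ i (w j)) = 1)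
    (η : NForm n (Model n)) (v : Fin n → Model n) :
    η v = (Matrix.of fun i j => θ i (v j)).det * η w := by
  set b := (EuclideanSpace.basisFun (Fin n) ℝ).toBasis
  have hη := fun v => congrArg (fun f => f v) (η.eq_smul_basis_det b)
  simp only [AlternatingMap.smul_apply, smul_eq_mul, Module.Basis.det_apply] at hη
  have h1 := congrArg Matrix.det (covector_matrix_eq_mul θ w)
  rw [hθ, Matrix.det_one, Matrix.det_mul] at h1
  rw [hη v, hη w, covector_matrix_eq_mul, Matrix.det_mul]
  linear_combination (η b * (b.toMatrix v).det) * h1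

theorem form_apply_ne_zero (hθ : (Matrix.of fun i j => θ i (w j)) = 1)
    {η : NForm n (Model n)} (hη : η ≠ 0) : η w ≠ 0 := by
  intro h
  apply hη
  ext v
  rw [form_apply_eq_det_mul hθ, h, mul_zero, AlternatingMap.zero_apply]

theorem nvector_apply_mul_dualForm (hθ : (Matrix.of fun i j => θ i (w j)) = 1)
    {lam : NVector n (Model n)} (hlam : lam ≠ 0) : lam θ * dualForm lam w = 1 := by
  rw [dualForm_spec lam hlam, hθ, Matrix.det_one]

theorem nvector_apply_eq_zero_iff (hθ : (Matrix.of fun i j => θ i (w j)) = 1)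
    {lam : NVector n (Model n)} : lam θ = 0 ↔ lam = 0 := by
  refine ⟨fun h => ?_, fun h => by rw [h, AlternatingMap.zero_apply]⟩
  by_contra hlam
  have := nvector_apply_mul_dualForm hθ hlam
  rw [h, zero_mul] at this
  exact zero_ne_one this

theorem dualForm_apply_frame (hθ : (Matrix.of fun i j => θ i (w j)) = 1)
    (lam : NVector n (Model n)) : dualForm lam w = (lam θ)⁻¹ := by
  by_cases hlam : lam = 0
  -- Both sides are $0$, by the conventions for `dualForm` and for $0^{-1}$.
  · simp [hlam, dualForm]
  · exact eq_inv_of_mul_eq_one_right (nvector_apply_mul_dualForm hθ hlam)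

/-- Change of coframe for an `n`-vector. -/
theorem nvector_apply_eq_det_mul (hθ : (Matrix.of fun i j => θ i (w j)) = 1)
    (lam : NVector n (Model n)) :
    lam θ' = (Matrix.of fun i j => θ' i (w j)).det * lam θ := by
  by_cases hlam : lam = 0
  · simp [hlam]
  · have h1 := dualForm_spec lam hlam θ' w
    have h2 := nvector_apply_mul_dualForm hθ hlam
    rw [← h1]
    linear_combination -(lam θ') * h2

end DualFrames

/-! ### Changes of chart and orientation signs -/

section Charts

variable {n : ℕ} {M : Type*} [TopologicalSpace M] [ChartedSpace (Model n) M]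

variable (n) in
/-- The Jacobian matrix at `x` of the change of coordinates from the chart at `q` to the chart
at `p`. -/
def jacobian (p q x : M) : Matrix (Fin n) (Fin n) ℝ :=
  Matrix.of fun i j => chartCoframe (chartAt (Model n) p) x i (chartFrame (chartAt (Model n) q) x j)

variable [IsManifold (𝓡 n) ∞ M] {p q x : M}

theorem contMDiffAt_chartAt (h : x ∈ (chartAt (Model n) p).source) :
    ContMDiffAt (𝓡 n) (𝓡 n) ∞ (chartAt (Model n) p) x :=
  contMDiffOn_chart.contMDiffAt ((chartAt (Model n) p).open_source.mem_nhds h)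

theorem contMDiffAt_chartAt_symm {y : Model n} (h : y ∈ (chartAt (Model n) p).target) :
    ContMDiffAt (𝓡 n) (𝓡 n) ∞ (chartAt (Model n) p).symm y :=
  contMDiffOn_chart_symm.contMDiffAt ((chartAt (Model n) p).open_target.mem_nhds h)

theorem jacobian_apply (hp : x ∈ (chartAt (Model n) p).source)
    (hq : x ∈ (chartAt (Model n) q).source) (i j : Fin n) :
    jacobian n p q x i j =
      fderiv ℝ (fun z => chartAt (Model n) p ((chartAt (Model n) q).symm z) i)
        (chartAt (Model n) q x) (EuclideanSpace.single j 1) := by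
  have hx : (chartAt (Model n) q).symm (chartAt (Model n) q x) = x :=
    (chartAt (Model n) q).left_inv hq
  have h1 : MDifferentiableAt (𝓡 n) (𝓡 n) (chartAt (Model n) q).symm (chartAt (Model n) q x) :=
    (contMDiffAt_chartAt_symm ((chartAt (Model n) q).map_source hq)).mdifferentiableAt
      (by norm_num)
  have h2 : MDifferentiableAt (𝓡 n) 𝓘(ℝ, ℝ) (fun y => chartAt (Model n) p y i) x :=
    (EuclideanSpace.proj (𝕜 := ℝ) i).mdifferentiableAt.comp x
      ((contMDiffAt_chartAt hp).mdifferentiableAt (by norm_num))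
  have h3 := mfderiv_comp (I := 𝓡 n) (I' := 𝓡 n) (I'' := 𝓘(ℝ, ℝ)) (chartAt (Model n) q x)
    (g := fun y => chartAt (Model n) p y i) (f := (chartAt (Model n) q).symm)
    (by rw [hx]; exact h2) h1
  rw [← mfderiv_eq_fderiv]
  rw [hx] at h3
  exact (congrArg (fun L => L (EuclideanSpace.single j (1 : ℝ))) h3).symm

theorem jacobian_self (hp : x ∈ (chartAt (Model n) p).source) : jacobian n p p x = 1 := by
  ext i j
  rw [jacobian_apply hp hp]
  have h1 : (fun z => chartAt (Model n) p ((chartAt (Model n) p).symm z) i) =ᶠ[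
      𝓝 (chartAt (Model n) p x)] fun z => EuclideanSpace.proj (𝕜 := ℝ) i z := by
    filter_upwards [(chartAt (Model n) p).open_target.mem_nhds
      ((chartAt (Model n) p).map_source hp)] with z hz
    rw [(chartAt (Model n) p).right_inv hz]
    rfl
  rw [h1.fderiv_eq, ContinuousLinearMap.fderiv]
  simp [Matrix.one_apply]

theorem continuousAt_det_jacobian (hp : x ∈ (chartAt (Model n) p).source)
    (hq : x ∈ (chartAt (Model n) q).source) : ContinuousAt (fun y => (jacobian n p q y).det) x := by
  have h : ∀ i j, ContinuousAt (fun y => jacobian n p q y i j) x := by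
    intro i j
    set τ : Model n → ℝ := fun z => chartAt (Model n) p ((chartAt (Model n) q).symm z) i with hτ
    have hτs : ContDiffAt ℝ ∞ τ (chartAt (Model n) q x) := by
      have hx : (chartAt (Model n) q).symm (chartAt (Model n) q x) = x :=
        (chartAt (Model n) q).left_inv hq
      have h1 : ContMDiffAt (𝓡 n) (𝓡 n) ∞
          (chartAt (Model n) p ∘ (chartAt (Model n) q).symm) (chartAt (Model n) q x) :=
        ContMDiffAt.comp _ (by rw [hx]; exact contMDiffAt_chartAt hp)
          (contMDiffAt_chartAt_symm ((chartAt (Model n) q).map_source hq))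
      exact (EuclideanSpace.proj (𝕜 := ℝ) i).contDiff.contDiffAt.comp _ h1.contDiffAt
    have h2 : ContinuousAt (fun z => fderiv ℝ τ z (EuclideanSpace.single j 1))
        (chartAt (Model n) q x) :=
      ((hτs.fderiv_right (m := 0) (by norm_cast)).continuousAt).clm_apply continuousAt_const
    have h3 : ContinuousAt (fun y => fderiv ℝ τ (chartAt (Model n) q y)
        (EuclideanSpace.single j 1)) x :=
      ContinuousAt.comp (g := fun z => fderiv ℝ τ z (EuclideanSpace.single j 1))
        h2 ((chartAt (Model n) q).continuousAt hq)
    refine h3.congr ?_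
    filter_upwards [(chartAt (Model n) p).open_source.mem_nhds hp,
      (chartAt (Model n) q).open_source.mem_nhds hq] with y hyp hyq
    exact (jacobian_apply hyp hyq i j).symm
  simp only [Matrix.det_apply]
  exact tendsto_finsetSum _ fun σ _ => (tendsto_finsetProd _ fun i _ => h (σ i) i).const_smul _

theorem form_chartFrame (hq : x ∈ (chartAt (Model n) q).source)
    (η : NForm n (TangentSpace (𝓡 n) x)) (p : M) :
    η (chartFrame (chartAt (Model n) p) x) =
      (jacobian n q p x).det * η (chartFrame (chartAt (Model n) q) x) :=
  form_apply_eq_det_mul (jacobian_self hq) η _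

theorem coeff_eq_det_mul (hq : x ∈ (chartAt (Model n) q).source) (Λ : NVectorField n M) (p : M) :
    coeff Λ (chartAt (Model n) p) x =
      (jacobian n p q x).det * coeff Λ (chartAt (Model n) q) x :=
  nvector_apply_eq_det_mul (jacobian_self hq) (Λ x)

theorem coeff_eq_zero_iff (hp : x ∈ (chartAt (Model n) p).source) (Λ : NVectorField n M) :
    coeff Λ (chartAt (Model n) p) x = 0 ↔ Λ x = 0 :=
  nvector_apply_eq_zero_iff (jacobian_self hp) (lam := Λ x)

theorem inverseForm_chartFrame (hp : x ∈ (chartAt (Model n) p).source) (Λ : NVectorField n M) :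
    inverseForm Λ x (chartFrame (chartAt (Model n) p) x) =
      (coeff Λ (chartAt (Model n) p) x)⁻¹ :=
  dualForm_apply_frame (jacobian_self hp) (Λ x)

/-- A nonzero $n$-form is carried from one frame to the other and back by the change of frame
formula; its value on a frame is nonzero and cancels. -/
theorem det_jacobian_mul (hp : x ∈ (chartAt (Model n) p).source)
    (hq : x ∈ (chartAt (Model n) q).source) :
    (jacobian n p q x).det * (jacobian n q p x).det = 1 := by
  set η : NForm n (Model n) := (EuclideanSpace.basisFun (Fin n) ℝ).toBasis.det
  have hη : η ≠ 0 := fun h => by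
    have h1 := (EuclideanSpace.basisFun (Fin n) ℝ).toBasis.det_self
    rw [show (EuclideanSpace.basisFun (Fin n) ℝ).toBasis.det = 0 from h] at h1
    exact zero_ne_one h1
  have h0 : η (chartFrame (chartAt (Model n) p) x) ≠ 0 := form_apply_ne_zero (jacobian_self hp) hη
  have h1 := form_chartFrame hq (x := x) η p
  have h2 := form_chartFrame hp (x := x) η q
  apply mul_right_cancel₀ h0
  rw [one_mul]
  linear_combination (jacobian n q p x).det * (-1 : ℝ) * h2 - h1

/-- The sign of the coordinate frame of the chart at `p`. -/
def chartSign (o : ManifoldOrientation n M) (p x : M) : ℝ :=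
  frameSign (o.orient x) (chartFrame (chartAt (Model n) p) x)

theorem chartSign_eq (o : ManifoldOrientation n M) (hq : x ∈ (chartAt (Model n) q).source) (p : M) :
    chartSign o p x = (SignType.sign (jacobian n q p x).det : ℝ) * chartSign o q x := by
  have h := form_chartFrame hq (Module.Ray.someVector (o.orient x)) p
  unfold chartSign frameSign
  rw [h, sign_mul, SignType.coe_mul]

theorem abs_chartSign (o : ManifoldOrientation n M) (hp : x ∈ (chartAt (Model n) p).source) :
    |chartSign o p x| = 1 := by
  have h : (Module.Ray.someVector (o.orient x) : NForm n (TangentSpace (𝓡 n) x))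
      (chartFrame (chartAt (Model n) p) x) ≠ 0 :=
    form_apply_ne_zero (jacobian_self hp) (Module.Ray.someVector_ne_zero (o.orient x))
  unfold chartSign frameSign
  rcases lt_or_gt_of_ne h with h | h
  · rw [sign_neg h]; simp
  · rw [sign_pos h]; simp

/-- `ManifoldOrientation` controls, near $x$, only the chart centred at $x$. The sign for the chart
at $p$ differs from it by the sign of a Jacobian determinant, which is continuous and nonzero at
$x$. -/
theorem chartSign_eventuallyEq (o : ManifoldOrientation n M)
    (hp : x ∈ (chartAt (Model n) p).source) :
    ∀ᶠ y in 𝓝 x, chartSign o p y = chartSign o p x := by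
  have hx := mem_chart_source (Model n) x
  have hdet : (jacobian n x p x).det ≠ 0 := left_ne_zero_of_mul_eq_one (det_jacobian_mul hx hp)
  have hsign : ∀ᶠ y in 𝓝 x, SignType.sign (jacobian n x p y).det =
      SignType.sign (jacobian n x p x).det := by
    have hc := continuousAt_det_jacobian hx hp
    rcases lt_or_gt_of_ne hdet with h | h
    · filter_upwards [hc.eventually (gt_mem_nhds h)] with y hy
      rw [sign_neg hy, sign_neg h]
    · filter_upwards [hc.eventually (lt_mem_nhds h)] with y hy
      rw [sign_pos hy, sign_pos h]
  filter_upwards [hsign, o.continuous_orient x, (chartAt (Model n) x).open_source.mem_nhds hx]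
    with y hy hoy hyx
  rw [chartSign_eq o hyx p, chartSign_eq o hx p, hy]
  exact congrArg _ hoy

/-- The sign of the coefficient of `Λ` with respect to a positively oriented chart does not depend
on the chart. -/
theorem chartSign_mul_coeff_mul_nonneg (o : ManifoldOrientation n M) (Λ : NVectorField n M)
    (hp : x ∈ (chartAt (Model n) p).source) (hq : x ∈ (chartAt (Model n) q).source) :
    0 ≤ (chartSign o p x * coeff Λ (chartAt (Model n) p) x) *
      (chartSign o q x * coeff Λ (chartAt (Model n) q) x) := by
  have hdet := det_jacobian_mul hp hq
  rw [chartSign_eq o hq p, coeff_eq_det_mul hq Λ p]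
  -- The frame and the coefficient change by mutually inverse determinants, which have the same
  -- sign.
  have hsign : 0 ≤ (SignType.sign (jacobian n q p x).det : ℝ) * (jacobian n p q x).det := by
    rcases lt_or_gt_of_ne (right_ne_zero_of_mul_eq_one hdet) with h | h
    · rw [sign_neg h]
      have : (jacobian n p q x).det ≤ 0 := by nlinarith
      simpa using this
    · rw [sign_pos h]
      have : 0 ≤ (jacobian n p q x).det := by nlinarith
      simpa using this
  have h2 : 0 ≤ (chartSign o q x * coeff Λ (chartAt (Model n) q) x) ^ 2 := sq_nonneg _
  calc 0 ≤ ((SignType.sign (jacobian n q p x).det : ℝ) * (jacobian n p q x).det) *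
        (chartSign o q x * coeff Λ (chartAt (Model n) q) x) ^ 2 := mul_nonneg hsign h2
    _ = _ := by ring

end Charts

/-! ### Transversality in different charts -/

section Differentials

variable {n : ℕ} {M : Type*} [TopologicalSpace M] [ChartedSpace (Model n) M]
  [IsManifold (𝓡 n) ∞ M] {p x : M}

theorem fderiv_comp_chartAt_symm_eq_zero_iff {f : M → ℝ}
    (hp : x ∈ (chartAt (Model n) p).source) (hf : MDifferentiableAt (𝓡 n) 𝓘(ℝ, ℝ) f x) :
    fderiv ℝ (fun y => f ((chartAt (Model n) p).symm y)) (chartAt (Model n) p x) = 0 ↔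
      mfderiv (𝓡 n) 𝓘(ℝ, ℝ) f x = 0 := by
  have hx : (chartAt (Model n) p).symm (chartAt (Model n) p x) = x :=
    (chartAt (Model n) p).left_inv hp
  have h1 : MDifferentiableAt (𝓡 n) (𝓡 n) (chartAt (Model n) p).symm (chartAt (Model n) p x) :=
    (contMDiffAt_chartAt_symm ((chartAt (Model n) p).map_source hp)).mdifferentiableAt
      (by norm_num)
  have h2 : MDifferentiableAt (𝓡 n) (𝓡 n) (chartAt (Model n) p) x :=
    (contMDiffAt_chartAt hp).mdifferentiableAt (by norm_num)
  have hf' : MDifferentiableAt (𝓡 n) 𝓘(ℝ, ℝ) f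
      ((chartAt (Model n) p).symm (chartAt (Model n) p x)) := by rw [hx]; exact hf
  have h3 := mfderiv_comp (chartAt (Model n) p x) hf' h1
  have h4 : MDifferentiableAt (𝓡 n) 𝓘(ℝ, ℝ) (f ∘ (chartAt (Model n) p).symm)
    (chartAt (Model n) p x) := hf'.comp _ h1
  have h5 := mfderiv_comp x h4 h2
  have h6 : (f ∘ (chartAt (Model n) p).symm) ∘ chartAt (Model n) p =ᶠ[𝓝 x] f := by
    filter_upwards [(chartAt (Model n) p).open_source.mem_nhds hp] with y hy
    simp only [Function.comp]
    rw [(chartAt (Model n) p).left_inv hy]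
  rw [h6.mfderiv_eq] at h5
  rw [hx] at h3
  rw [← mfderiv_eq_fderiv]
  constructor
  · intro h
    rw [h5]
    rw [show mfderiv (𝓡 n) 𝓘(ℝ, ℝ) (f ∘ (chartAt (Model n) p).symm) (chartAt (Model n) p x) = 0
      from h]
    exact ContinuousLinearMap.zero_comp _
  · intro h
    refine Eq.trans h3 ?_
    rw [h]
    exact ContinuousLinearMap.zero_comp _

/-- Here $f(y)=o(|y-z|)$ and $g=O(f)$. Transversality can thus be transferred by an inequality,
without differentiating Jacobians or partition functions. -/
theorem hasFDerivAt_zero_of_abs_le {E : Type*} [NormedAddCommGroup E] [NormedSpace ℝ E]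
    {f g : E → ℝ} {z : E} {C : ℝ} (hf : HasFDerivAt f (0 : E →L[ℝ] ℝ) z) (hfz : f z = 0)
    (hgf : ∀ᶠ y in 𝓝 z, |g y| ≤ C * |f y|) : HasFDerivAt g (0 : E →L[ℝ] ℝ) z := by
  have hgz : g z = 0 := by
    have := hgf.self_of_nhds
    rw [hfz, abs_zero, mul_zero] at this
    exact abs_nonpos_iff.1 this
  rw [hasFDerivAt_iff_isLittleO] at hf ⊢
  simp only [hfz, hgz, sub_zero, zero_apply] at hf ⊢
  exact (Asymptotics.IsBigO.of_bound C hgf).trans_isLittleO hf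

/-- If `g` is dominated by `f` near a zero of `f` at which `df = 0`, then `dg = 0`. -/
theorem mfderiv_eq_zero_of_abs_le {f g : M → ℝ} {C : ℝ}
    (hf : MDifferentiableAt (𝓡 n) 𝓘(ℝ, ℝ) f x) (hg : MDifferentiableAt (𝓡 n) 𝓘(ℝ, ℝ) g x)
    (hfx : f x = 0) (hgf : ∀ᶠ y in 𝓝 x, |g y| ≤ C * |f y|)
    (h : mfderiv (𝓡 n) 𝓘(ℝ, ℝ) f x = 0) : mfderiv (𝓡 n) 𝓘(ℝ, ℝ) g x = 0 := by
  have hxs := mem_chart_source (Model n) x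
  have hx : (chartAt (Model n) x).symm (chartAt (Model n) x x) = x :=
    (chartAt (Model n) x).left_inv hxs
  have h1 : MDifferentiableAt (𝓡 n) (𝓡 n) (chartAt (Model n) x).symm (chartAt (Model n) x x) :=
    (contMDiffAt_chartAt_symm ((chartAt (Model n) x).map_source hxs)).mdifferentiableAt
      (by norm_num)
  rw [← fderiv_comp_chartAt_symm_eq_zero_iff hxs hf] at h
  rw [← fderiv_comp_chartAt_symm_eq_zero_iff hxs hg]
  have hfd : DifferentiableAt ℝ (fun y => f ((chartAt (Model n) x).symm y))
      (chartAt (Model n) x x) :=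
    mdifferentiableAt_iff_differentiableAt.1
      (MDifferentiableAt.comp (chartAt (Model n) x x) (by rw [hx]; exact hf) h1)
  have h2 := hfd.hasFDerivAt
  rw [h] at h2
  refine (hasFDerivAt_zero_of_abs_le h2 (by rw [hx]; exact hfx) (C := C) ?_
    (g := fun y => g ((chartAt (Model n) x).symm y))).fderiv
  have h3 : Tendsto (chartAt (Model n) x).symm (𝓝 (chartAt (Model n) x x)) (𝓝 x) := by
    have := h1.continuousAt
    rwa [ContinuousAt, hx] at this
  exact h3.eventually hgf

omit [IsManifold (𝓡 n) ∞ M] in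
theorem IsGeneric.contMDiffAt_coeff {Λ : NVectorField n M} (hΛ : IsGeneric Λ)
    (hp : x ∈ (chartAt (Model n) p).source) :
    ContMDiffAt (𝓡 n) 𝓘(ℝ, ℝ) ∞ (coeff Λ (chartAt (Model n) p)) x :=
  (hΛ.smooth p).contMDiffAt ((chartAt (Model n) p).open_source.mem_nhds hp)

/-- Transversality can be checked in any chart. -/
theorem IsGeneric.mfderiv_coeff_ne_zero {Λ : NVectorField n M} (hΛ : IsGeneric Λ)
    (hp : x ∈ (chartAt (Model n) p).source) (hx : Λ x = 0) :
    mfderiv (𝓡 n) 𝓘(ℝ, ℝ) (coeff Λ (chartAt (Model n) p)) x ≠ 0 := by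
  intro h
  have hxs := mem_chart_source (Model n) x
  -- The coefficient in the chart at $x$ is that in the chart at $p$ times a determinant bounded
  -- near $x$ by this constant.
  refine hΛ.transverse x hx (mfderiv_eq_zero_of_abs_le (C := |(jacobian n x p x).det| + 1)
    ((hΛ.contMDiffAt_coeff hp).mdifferentiableAt (by norm_num))
    ((hΛ.contMDiffAt_coeff hxs).mdifferentiableAt (by norm_num))
    ((coeff_eq_zero_iff hp Λ).2 hx) ?_ h)
  have hc := (continuousAt_det_jacobian hxs hp).abs
  filter_upwards [hc.eventually (gt_mem_nhds (lt_add_one _)),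
    (chartAt (Model n) p).open_source.mem_nhds hp] with y hy hyp
  rw [coeff_eq_det_mul hyp Λ x, abs_mul]
  gcongr

end Differentials

/-! ### Existence of $h$ and the regularized volume on the manifold -/

section Volume

variable {n : ℕ} {M : Type*} [TopologicalSpace M] [ChartedSpace (Model n) M]
  [T2Space M] [CompactSpace M] [IsManifold (𝓡 n) ∞ M]

variable (n M) in
theorem partition_isSubordinate :
    (partition n M).IsSubordinate fun p => (chartAt (Model n) p).source :=
  (exists_partition n M).choose_spec

theorem mem_chart_source_of_partition_ne_zero {p x : M} (h : partition n M p x ≠ 0) :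
    x ∈ (chartAt (Model n) p).source :=
  partition_isSubordinate n M p (subset_tsupport _ h)

variable (n) in
theorem exists_partition_pos (x : M) : ∃ p, 0 < partition n M p x :=
  (partition n M).exists_pos_of_mem (Set.mem_univ x)

variable (n M) in
theorem finite_partition_ne_zero : {p : M | ∃ x, partition n M p x ≠ 0}.Finite :=
  (partition n M).locallyFinite.finite_nonempty_of_compact

/-- The partition function at `p`, with the sign of the chart at `p`, in the coordinates of that
chart. -/
def chartCutoff (o : ManifoldOrientation n M) (p : M) : Model n → ℝ :=
  (chartAt (Model n) p).target.indicator fun y =>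
    partition n M p ((chartAt (Model n) p).symm y) * chartSign o p ((chartAt (Model n) p).symm y)

variable (n) in
theorem isCompact_image_tsupport_partition (p : M) :
    IsCompact (chartAt (Model n) p '' tsupport (partition n M p)) :=
  (isClosed_tsupport _).isCompact.image_of_continuousOn
    ((chartAt (Model n) p).continuousOn.mono (partition_isSubordinate n M p))

theorem tsupport_chartCutoff_subset (o : ManifoldOrientation n M) (p : M) :
    tsupport (chartCutoff o p) ⊆ chartAt (Model n) p '' tsupport (partition n M p) := by
  refine closure_minimal (fun y hy => ?_) (isCompact_image_tsupport_partition n p).isClosed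
  have hyt : y ∈ (chartAt (Model n) p).target := Set.mem_of_indicator_ne_zero hy
  rw [Function.mem_support, chartCutoff, Set.indicator_of_mem hyt] at hy
  exact ⟨_, subset_tsupport _ (left_ne_zero_of_mul hy), (chartAt (Model n) p).right_inv hyt⟩

theorem hasCompactSupport_chartCutoff (o : ManifoldOrientation n M) (p : M) :
    HasCompactSupport (chartCutoff o p) :=
  (isCompact_image_tsupport_partition n p).of_isClosed_subset (isClosed_tsupport _)
    (tsupport_chartCutoff_subset o p)

theorem tsupport_chartCutoff_subset_target (o : ManifoldOrientation n M) (p : M) :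
    tsupport (chartCutoff o p) ⊆ (chartAt (Model n) p).target := by
  refine (tsupport_chartCutoff_subset o p).trans ?_
  rintro _ ⟨x, hx, rfl⟩
  exact (chartAt (Model n) p).map_source (partition_isSubordinate n M p hx)

omit [T2Space M] [CompactSpace M] in
theorem contDiffOn_comp_chartAt_symm {f : M → ℝ} {p : M}
    (hf : ∀ x ∈ (chartAt (Model n) p).source, ContMDiffAt (𝓡 n) 𝓘(ℝ, ℝ) ∞ f x) :
    ContDiffOn ℝ ∞ (fun y => f ((chartAt (Model n) p).symm y)) (chartAt (Model n) p).target :=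
  fun y hy => by
    have h1 : ContMDiffAt (𝓡 n) 𝓘(ℝ, ℝ) ∞ (f ∘ (chartAt (Model n) p).symm) y :=
      (hf _ ((chartAt (Model n) p).map_target hy)).comp y (contMDiffAt_chartAt_symm hy)
    exact h1.contDiffAt.contDiffWithinAt

/-- The sign is locally constant on the chart domain, and the support is a compact subset of the
target, so extension by zero is smooth. -/
theorem contDiff_chartCutoff (o : ManifoldOrientation n M) (p : M) :
    ContDiff ℝ ∞ (chartCutoff o p) := by
  rw [contDiff_iff_contDiffAt]
  intro y
  by_cases hy : y ∈ tsupport (chartCutoff o p)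
  · have hyt := tsupport_chartCutoff_subset_target o p hy
    have hys := (chartAt (Model n) p).map_target hyt
    have h1 : ContDiffAt ℝ ∞ (fun z => partition n M p ((chartAt (Model n) p).symm z)) y :=
      (contDiffOn_comp_chartAt_symm fun x _ => (partition n M p).contMDiff.contMDiffAt).contDiffAt
        ((chartAt (Model n) p).open_target.mem_nhds hyt)
    refine (h1.mul (contDiffAt_const
      (c := chartSign o p ((chartAt (Model n) p).symm y)))).congr_of_eventuallyEq ?_
    filter_upwards [(chartAt (Model n) p).open_target.mem_nhds hyt,
      ((chartAt (Model n) p).symm.continuousAt hyt).eventually (chartSign_eventuallyEq o hys)]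
      with z hz hzs
    rw [chartCutoff, Set.indicator_of_mem hz, hzs]
  · refine (contDiffAt_const (c := (0 : ℝ))).congr_of_eventuallyEq ?_
    filter_upwards [(isClosed_tsupport _).isOpen_compl.mem_nhds hy] with z hz
    exact image_eq_zero_of_notMem_tsupport hz

/-- This brings the contribution of each chart to the Euclidean form $f\,c^{-1}$, with the
orientation sign absorbed in the cutoff $f$. -/
theorem localIntegrand_inverseForm (o : ManifoldOrientation n M) (Λ : NVectorField n M) (h : M → ℝ)
    (ε : ℝ) {p : M} {y : Model n} (hy : y ∈ (chartAt (Model n) p).target) :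
    localIntegrand o (inverseForm Λ) (outside h ε) p y =
      {y | ε ≤ |h ((chartAt (Model n) p).symm y)|}.indicator (fun y => chartCutoff o p y *
        (coeff Λ (chartAt (Model n) p) ((chartAt (Model n) p).symm y))⁻¹) y := by
  have h1 : chartDensity o (inverseForm Λ) (chartAt (Model n) p) y =
      chartSign o p ((chartAt (Model n) p).symm y) *
        (coeff Λ (chartAt (Model n) p) ((chartAt (Model n) p).symm y))⁻¹ := by
    rw [← inverseForm_chartFrame ((chartAt (Model n) p).map_target hy) Λ]
    rfl
  rw [localIntegrand, h1]
  by_cases hε : ε ≤ |h ((chartAt (Model n) p).symm y)|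
  · have h2 : (chartAt (Model n) p).symm y ∈ outside h ε := hε
    rw [Set.indicator_of_mem h2, Set.indicator_of_mem (by exact hε), chartCutoff,
      Set.indicator_of_mem hy, Pi.one_apply]
    ring
  · have h2 : (chartAt (Model n) p).symm y ∉ outside h ε := hε
    rw [Set.indicator_of_notMem h2, Set.indicator_of_notMem (by exact hε)]
    ring

omit [T2Space M] [CompactSpace M] in
theorem IsGeneric.fderiv_coeff_ne_zero {Λ : NVectorField n M} (hΛ : IsGeneric Λ) (p : M) :
    ∀ y ∈ (chartAt (Model n) p).target,
      coeff Λ (chartAt (Model n) p) ((chartAt (Model n) p).symm y) = 0 →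
      fderiv ℝ (fun y => coeff Λ (chartAt (Model n) p) ((chartAt (Model n) p).symm y)) y ≠ 0 := by
  intro y hy h0 h
  have hx := (chartAt (Model n) p).map_target hy
  refine hΛ.mfderiv_coeff_ne_zero hx ((coeff_eq_zero_iff hx Λ).1 h0) ?_
  rw [← fderiv_comp_chartAt_symm_eq_zero_iff hx
    ((hΛ.contMDiffAt_coeff hx).mdifferentiableAt (by norm_num)),
    (chartAt (Model n) p).right_inv hy]
  exact h

omit [T2Space M] [CompactSpace M] in
theorem VanishesLinearlyExactlyOn.fderiv_ne_zero {h : M → ℝ} {Z : Set M}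
    (hh : VanishesLinearlyExactlyOn n h Z) (p : M) :
    ∀ y ∈ (chartAt (Model n) p).target, h ((chartAt (Model n) p).symm y) = 0 →
      fderiv ℝ (fun y => h ((chartAt (Model n) p).symm y)) y ≠ 0 := by
  intro y hy h0 hd
  refine hh.transverse _ h0 ?_
  rw [← fderiv_comp_chartAt_symm_eq_zero_iff ((chartAt (Model n) p).map_target hy)
    (hh.smooth.contMDiffAt.mdifferentiableAt (by norm_num)), (chartAt (Model n) p).right_inv hy]
  exact hd

omit [T2Space M] [CompactSpace M] in
theorem VanishesLinearlyExactlyOn.eq_zero_iff_coeff {h : M → ℝ} {Λ : NVectorField n M}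
    (hh : VanishesLinearlyExactlyOn n h (zeroLocus Λ)) (p : M) :
    ∀ y ∈ (chartAt (Model n) p).target, h ((chartAt (Model n) p).symm y) = 0 ↔
      coeff Λ (chartAt (Model n) p) ((chartAt (Model n) p).symm y) = 0 := by
  intro y hy
  rw [hh.zero_iff, coeff_eq_zero_iff ((chartAt (Model n) p).map_target hy)]
  rfl

theorem formIntegrableOn_outside (o : ManifoldOrientation n M) {Λ : NVectorField n M}
    (hΛ : IsGeneric Λ) {h : M → ℝ} (hh : VanishesLinearlyExactlyOn n h (zeroLocus Λ)) {ε : ℝ}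
    (hε : 0 < ε) : FormIntegrableOn o (inverseForm Λ) (outside h ε) := by
  intro p
  have hc := contDiffOn_comp_chartAt_symm (p := p) fun x hx => hΛ.contMDiffAt_coeff hx
  have hhs := contDiffOn_comp_chartAt_symm (p := p) fun x _ => hh.smooth.contMDiffAt (x := x)
  have h1 := integrable_indicator_mul volume (contDiff_chartCutoff o p).continuous
    (hasCompactSupport_chartCutoff o p) (tsupport_chartCutoff_subset_target o p)
    hhs.continuousOn
    (k := fun y => (coeff Λ (chartAt (Model n) p) ((chartAt (Model n) p).symm y))⁻¹)
    ((hc.continuousOn.mono Set.inter_subset_left).inv₀ fun y hy h0 =>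
      hy.2 ((hh.eq_zero_iff_coeff p y hy.1).2 h0)) hε
  exact h1.integrableOn.congr_fun (fun y hy => (localIntegrand_inverseForm o Λ h ε hy).symm)
    (chartAt (Model n) p).open_target.measurableSet

theorem exists_tendsto_truncatedVolume (o : ManifoldOrientation n M) {Λ : NVectorField n M}
    (hΛ : IsGeneric Λ) : ∃ V : ℝ, ∀ h : M → ℝ, VanishesLinearlyExactlyOn n h (zeroLocus Λ) →
      Tendsto (fun ε : ℝ => truncatedVolume o Λ h ε) (𝓝[>] 0) (𝓝 V) := by
  have hloc := fun p => exists_tendsto_integral_indicator_div volume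
    (chartAt (Model n) p).open_target
    (contDiffOn_comp_chartAt_symm (p := p) fun x hx => hΛ.contMDiffAt_coeff hx)
    (hΛ.fderiv_coeff_ne_zero p) (contDiff_chartCutoff o p)
    (hasCompactSupport_chartCutoff o p) (tsupport_chartCutoff_subset_target o p)
  choose V hV using hloc
  refine ⟨∑ p ∈ (finite_partition_ne_zero n M).toFinset, V p, fun h hh => ?_⟩
  have hlim := fun p => hV p _
    (contDiffOn_comp_chartAt_symm (p := p) fun x _ => hh.smooth.contMDiffAt (x := x))
    (hh.eq_zero_iff_coeff p) (hh.fderiv_ne_zero p)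
  refine (tendsto_finsetSum _ fun p _ => hlim p).congr fun ε => ?_
  rw [truncatedVolume, formIntegral, finsum_eq_sum_of_support_subset _
    (s := (finite_partition_ne_zero n M).toFinset)]
  · refine Finset.sum_congr rfl fun p _ => ?_
    rw [setIntegral_congr_fun (chartAt (Model n) p).open_target.measurableSet
      fun y hy => localIntegrand_inverseForm o Λ h ε hy]
    refine (setIntegral_eq_integral_of_forall_compl_eq_zero fun y hy => ?_).symm
    simp [Set.indicator, chartCutoff, hy]
  · intro p hp
    rw [Set.Finite.coe_toFinset]
    by_contra hp'
    refine hp ?_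
    have h0 : ∀ x, partition n M p x = 0 := fun x => by
      by_contra hx
      exact hp' ⟨x, hx⟩
    simp [localIntegrand, h0]

/-- The function obtained by pairing `Λ` with a positive volume form. -/
theorem exists_vanishesLinearlyExactlyOn_zeroLocus (o : ManifoldOrientation n M)
    {Λ : NVectorField n M} (hΛ : IsGeneric Λ) :
    ∃ h : M → ℝ, VanishesLinearlyExactlyOn n h (zeroLocus Λ) := by
  set k : M → M → ℝ := fun p x => chartSign o p x * coeff Λ (chartAt (Model n) p) x with hk
  set h : M → ℝ := fun x => ∑ᶠ p, partition n M p x • k p x with hh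
  have hsmooth : ContMDiff (𝓡 n) 𝓘(ℝ, ℝ) ∞ h := by
    refine (partition_isSubordinate n M).contMDiff_finsum_smul
      (fun p => (chartAt (Model n) p).open_source) fun p x hx => ?_
    have h1 : ContMDiffAt (𝓡 n) 𝓘(ℝ, ℝ) ∞
        (fun y => chartSign o p x * coeff Λ (chartAt (Model n) p) y) x :=
      contMDiffAt_const.mul (hΛ.contMDiffAt_coeff hx)
    refine (h1.congr_of_eventuallyEq ?_).contMDiffWithinAt
    filter_upwards [chartSign_eventuallyEq o hx] with y hy
    simp only [hk, hy]
  have hle : ∀ p, ∀ x ∈ (chartAt (Model n) p).source,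
      partition n M p x * |coeff Λ (chartAt (Model n) p) x| ≤ |h x| := by
    intro p x hx
    have habs : |k p x| = |coeff Λ (chartAt (Model n) p) x| := by
      rw [hk]
      simp only
      rw [abs_mul, abs_chartSign o hx, one_mul]
    rw [← habs]
    -- All the $k_q(x)$ that contribute have compatible signs, so after multiplication by $k_p(x)$
    -- the sum dominates its $p$-th term.
    have hnn : ∀ q, 0 ≤ (partition n M q x • k q x) * k p x := by
      intro q
      by_cases hq : partition n M q x = 0
      · simp [hq]
      · rw [smul_eq_mul, mul_assoc]
        exact mul_nonneg ((partition n M).nonneg q x)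
          (chartSign_mul_coeff_mul_nonneg o Λ (mem_chart_source_of_partition_ne_zero hq) hx)
    have h1 : (partition n M p x • k p x) * k p x ≤ h x * k p x := by
      rw [hh]
      simp only
      rw [finsum_mul]
      refine single_le_finsum p (f := fun q => (partition n M q x • k q x) * k p x)
        ((finite_partition_ne_zero n M).subset fun q hq => ⟨x, fun h0 => hq (by simp [h0])⟩) hnn
    rcases eq_or_ne (k p x) 0 with h0 | h0
    · rw [h0, abs_zero, mul_zero]; exact abs_nonneg _
    · have h2 : (partition n M p x * |k p x|) * |k p x| ≤ |h x| * |k p x| := by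
        rw [mul_assoc, abs_mul_abs_self, ← abs_mul]
        refine le_trans (le_of_eq ?_) (h1.trans (le_abs_self _))
        rw [smul_eq_mul]
        ring
      exact le_of_mul_le_mul_right h2 (abs_pos.2 h0)
  have hzero : ∀ x, h x = 0 ↔ x ∈ zeroLocus Λ := by
    intro x
    constructor
    · intro h0
      obtain ⟨p, hp⟩ := exists_partition_pos n x
      have hx := mem_chart_source_of_partition_ne_zero hp.ne'
      have h1 := hle p x hx
      rw [h0, abs_zero] at h1
      refine (coeff_eq_zero_iff hx Λ).1 (abs_nonpos_iff.1 ?_)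
      exact nonpos_of_mul_nonpos_right h1 hp
    · intro hx
      have hx' : Λ x = 0 := hx
      have h1 : ∀ p, coeff Λ (chartAt (Model n) p) x = 0 := fun p => by
        rw [coeff, hx', AlternatingMap.zero_apply]
      simp [hh, hk, h1]
  refine ⟨h, hsmooth, hzero, fun x h0 hd => ?_⟩
  obtain ⟨p, hp⟩ := exists_partition_pos n x
  have hx := mem_chart_source_of_partition_ne_zero hp.ne'
  -- Near $x$ the function $\rho_p$ exceeds half its value at $x$, so the coefficient at $p$ is at
  -- most this constant times $|h|$, and $dh_x=0$ would contradict its transversality.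
  refine hΛ.mfderiv_coeff_ne_zero hx ((hzero x).1 h0) (mfderiv_eq_zero_of_abs_le
    (C := (partition n M p x / 2)⁻¹) (hsmooth.contMDiffAt.mdifferentiableAt (by norm_num))
    ((hΛ.contMDiffAt_coeff hx).mdifferentiableAt (by norm_num)) h0 ?_ hd)
  have hρ : ContinuousAt (partition n M p) x := (partition n M p).contMDiff.continuous.continuousAt
  filter_upwards [hρ.eventually (lt_mem_nhds (half_lt_self hp)),
    (chartAt (Model n) p).open_source.mem_nhds hx] with y hy hyp
  rw [le_inv_mul_iff₀ (by positivity)]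
  refine le_trans ?_ (hle p y hyp)
  gcongr

end Volume

end NambuVolume

end

theorem mainTheorem5 {n : ℕ} {M : Type*} [TopologicalSpace M] [T2Space M] [CompactSpace M]
    [ChartedSpace (NambuVolume.Model n) M] [IsManifold (𝓡 n) ∞ M]
    (o : NambuVolume.ManifoldOrientation n M)
    (Λ : NambuVolume.NVectorField n M) (hΛ : NambuVolume.IsGeneric Λ) :
    (∃ h : M → ℝ, NambuVolume.VanishesLinearlyExactlyOn n h (NambuVolume.zeroLocus Λ)) ∧
    (∀ h : M → ℝ, NambuVolume.VanishesLinearlyExactlyOn n h (NambuVolume.zeroLocus Λ) →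
      ∀ ε : ℝ, 0 < ε →
        NambuVolume.FormIntegrableOn o (NambuVolume.inverseForm Λ) (NambuVolume.outside h ε)) ∧
    ∃! V : ℝ, ∀ h : M → ℝ,
      NambuVolume.VanishesLinearlyExactlyOn n h (NambuVolume.zeroLocus Λ) →
        Tendsto (fun ε : ℝ => NambuVolume.truncatedVolume o Λ h ε) (𝓝[>] 0) (𝓝 V) := by
  obtain ⟨h, hh⟩ := NambuVolume.exists_vanishesLinearlyExactlyOn_zeroLocus o hΛ
  obtain ⟨V, hV⟩ := NambuVolume.exists_tendsto_truncatedVolume o hΛ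
  -- Uniqueness of $V$ needs the existence of some $h$; otherwise the condition on $V$ would be
  -- vacuous.
  exact ⟨⟨h, hh⟩, fun h hh ε hε => NambuVolume.formIntegrableOn_outside o hΛ hh hε,
    V, hV, fun W hW => tendsto_nhds_unique (hW h hh) (hV h hh)⟩
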